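/- **Proposition.** Let $\nu=E^{\nu_0}NE^{\nu_1}\cdots NE^{\nu_n}$ be a northeast lattice path, identified with $(\nu_0,\dots,\nu_n)\in\mathbb{Z}_{\ge 0}^{n+1}$ ($n\ge 0$), and let $\delta=(\delta_1,\dots,\delta_n)$ be an increment vector, i.e. a vector of integers with $0\le\delta_i\le\nu_i$ for $1\le i\le n$. *The lattice.* Let $\check\nu=(\check\nu_0,\delta_1,\dots,\delta_n)$ with $\check\nu_0=\sum_{i=0}^n\nu_i-\sum_{i=1}^n\delta_i$, let $F_{\check\nu}$ be the region weakly above the path $\check\nu$ in its bounding rectangle, and let $\hat\nu=W^{\nu_0}NW^{\nu_1-\delta_1}\cdots NW^{\nu_n-\delta_n}$, starting at $(\check\nu_0,0)$. Let $L_{\delta,\nu}$ be the set of lattice points of $F_{\check\nu}$ weakly above $\hat\nu$. Two points of $L_{\delta,\nu}$ are incompatible if one is strictly southwest of the other and the smallest rectangle containing both lies in $F_{\check\nu}$. A $(\delta,\nu)$-tree is a maximal set of pairwise compatible points of $L_{\delta,\nu}$; its elements are called nodes. If $p,q,r$ are nodes of a $(\delta,\nu)$-tree $T$ with $p$ strictly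 above $q$ in the same column and $r$ strictly to the right of $q$ in the same row, and if the smallest rectangle containing $p$ and $r$ contains no node of $T$ other than $p,q,r$, then exchanging $q$ for the upper right corner of that rectangle is a right rotation of $T$. The alt $\nu$-Tamari lattice $\mathrm{Tam}_\nu(\delta)$ is the set of $(\delta,\nu)$-trees, ordered by $T\le T'$ if $T'$ is obtained from $T$ by a sequence of right rotations between $(\delta,\nu)$-trees. *The complex.* In a finite lattice, an element is join-irreducible if it covers exactly one element, and a join-representation of $a$ is a set of join-irreducible elements with join $a$; it is irredundant if no proper subset has join $a$. The canonical join representation of $a$, if it exists, is the irredundant join-representation $A$ of $a$ such that for every join-representation $B$ of $a$ each element of $A$ lies below some element of $B$. The canonical join complex is the simplicial complex whose faces are the canonical join representations of the elements. The Euler characteristic of a finite simplicial complex $\Delta$ is $\chi(\Delta)=\sum_{i\ge 0}(-1)^i f_i(\Delta)$, where $f_i(\Delta)$ is the number of faces with $i+1$ elements. *The polynomial.* A $\nu$-path is a northeast path with the same endpoints as $\nu$ that lies weakly above $\nu$, a valley is a consecutive pair of steps $EN$, and $N_\nu(x)=\sum_{i\ge 0}\mathrm{Nar}_\nu(i)\,x^i$,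 where $\mathrm{Nar}_\nu(i)$ is the number of $\nu$-paths with exactly $i$ valleys. *Claim.* $\mathrm{Tam}_\nu(\delta)$ is a lattice in which every element has a canonical join representation, and its canonical join complex $\Delta_{\mathrm{Tam}_\nu(\delta)}$ satisfies $$\chi\bigl(\Delta_{\mathrm{Tam}_\nu(\delta)}\bigr)=1-N_\nu(-1).$$ In particular, for fixed $\nu$ the Euler characteristic does not depend on the increment vector $\delta$. -/

import Mathlib

/-! ## Canonical join complexes of partial orders -/

namespace CanonicalJoin

variable {P : Type*} [PartialOrder P]

/-- `j` is join-irreducible: it covers exactly one element. -/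
def JoinIrr (j : P) : Prop := ∃! i, i ⋖ j

/-- `A` is a join-representation of `a`: a set of join-irreducible elements with join `a`. -/
def IsJoinRep (A : Finset P) (a : P) : Prop :=
  (∀ j ∈ A, JoinIrr j) ∧ IsLUB (A : Set P) a

/-- `A` refines `B`: each element of `A` is below some element of `B`. -/
def Refines (A B : Finset P) : Prop := ∀ x ∈ A, ∃ y ∈ B, x ≤ y

/-- `A` is the canonical join representation of `a`: it is an irredundant join-representation
of `a` (no proper subset has join `a`) which refines all join-representations of `a`.
Irredundancy is what makes a minimum for the preorder `Refines` unique. -/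
def IsCanonicalJoinRep (A : Finset P) (a : P) : Prop :=
  IsJoinRep A a ∧ (∀ B, B ⊂ A → ¬ IsJoinRep B a) ∧ ∀ B, IsJoinRep B a → Refines A B

variable (P) in
/-- The partial order `P` is a lattice: any two elements have a join and a meet. -/
def IsLatticeOrder : Prop :=
  ∀ x y : P, (∃ z, IsLUB {x, y} z) ∧ (∃ z, IsGLB {x, y} z)

theorem IsLatticeOrder.exists_isLUB (h : IsLatticeOrder P) {A : Finset P} (hA : A.Nonempty) :
    ∃ a, IsLUB (A : Set P) a := by
  classical
  induction hA using Finset.Nonempty.cons_induction with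
  | singleton a => exact ⟨a, by simp⟩
  | cons a s ha hs ih =>
    obtain ⟨b, hb⟩ := ih
    obtain ⟨c, hc⟩ := (h a b).1
    refine ⟨c, ?_⟩
    rw [Finset.coe_cons]
    constructor
    · rintro x (rfl | hx)
      · exact hc.1 (by simp)
      · exact (hb.1 hx).trans (hc.1 (by simp))
    · intro u hu
      apply hc.2
      rintro x (rfl | rfl)
      · exact hu (by simp)
      · exact hb.2 fun y hy => hu (Set.mem_insert_of_mem _ hy)

/-- Part of a join may be replaced by another set with the same join. -/
theorem isJoinRep_replace [DecidableEq P] {S S' U : Finset P} {a b : P} (hS : IsJoinRep S a)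
    (hS' : IsLUB (S' : Set P) b) (hU : IsJoinRep U b) (hsub : S' ⊆ S) :
    IsJoinRep (U ∪ (S \ S')) a := by
  refine ⟨?_, ?_, ?_⟩
  · intro j hj
    rcases Finset.mem_union.1 hj with hj | hj
    · exact hU.1 j hj
    · exact hS.1 j (Finset.mem_sdiff.1 hj).1
  · intro x hx
    rcases Finset.mem_union.1 (Finset.mem_coe.1 hx) with hx | hx
    · exact (hU.2.1 hx).trans (hS'.2 fun y hy => hS.2.1 (hsub hy))
    · exact hS.2.1 (Finset.mem_sdiff.1 hx).1
  · intro u hu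
    apply hS.2.2
    intro x hx
    by_cases hx' : x ∈ S'
    · refine (hS'.1 hx').trans (hU.2.2 fun y hy => hu ?_)
      exact Finset.mem_coe.2 (Finset.mem_union_left _ hy)
    · exact hu (Finset.mem_coe.2 (Finset.mem_union_right _ (Finset.mem_sdiff.2 ⟨hx, hx'⟩)))

/-- Every nonempty subset of a canonical join representation is one. -/
theorem IsCanonicalJoinRep.subset (h : IsLatticeOrder P) {S S' : Finset P} {a : P}
    (hS : IsCanonicalJoinRep S a) (hsub : S' ⊆ S) (hne : S'.Nonempty) :
    ∃ b, IsCanonicalJoinRep S' b := by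
  classical
  obtain ⟨b, hb⟩ := h.exists_isLUB hne
  obtain ⟨hS1, hS2, hS3⟩ := hS
  refine ⟨b, ⟨fun j hj => hS1.1 j (hsub hj), hb⟩, ?_, ?_⟩
  · intro B hB hBb
    refine hS2 _ ?_ (isJoinRep_replace hS1 hb hBb hsub)
    have hB1 : B ⊆ S' := hB.1
    obtain ⟨x, hx, hxB⟩ := (Finset.ssubset_iff_of_subset hB1).1 hB
    refine (Finset.ssubset_iff_of_subset ?_).2 ⟨x, hsub hx, ?_⟩
    · exact Finset.union_subset (hB1.trans hsub) Finset.sdiff_subset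
    · simp [hxB, hx]
  · intro U hU x hx
    obtain ⟨y, hy, hxy⟩ := hS3 _ (isJoinRep_replace hS1 hb hU hsub) x (hsub hx)
    rcases Finset.mem_union.1 hy with hy | hy
    · exact ⟨y, hy, hxy⟩
    · exfalso
      obtain ⟨hyS, hyS'⟩ := Finset.mem_sdiff.1 hy
      have hyx : y ≠ x := fun e => hyS' (e ▸ hx)
      refine hS2 (S.erase x) (Finset.erase_ssubset (hsub hx)) ⟨?_, ?_, ?_⟩
      · exact fun j hj => hS1.1 j (Finset.mem_of_mem_erase hj)
      · exact fun z hz => hS1.2.1 (Finset.mem_of_mem_erase (Finset.mem_coe.1 hz))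
      · intro u hu
        apply hS1.2.2
        intro z hz
        by_cases hzx : z = x
        · subst hzx
          exact hxy.trans (hu (Finset.mem_coe.2 (Finset.mem_erase.2 ⟨hyx, hyS⟩)))
        · exact hu (Finset.mem_coe.2 (Finset.mem_erase.2 ⟨hzx, hz⟩))

/-- The canonical join complex of a lattice: its faces are the (nonempty) canonical join
representations of the elements of the lattice. -/
def canonicalJoinComplex (h : IsLatticeOrder P) : PreAbstractSimplicialComplex P where
  faces := {A | A.Nonempty ∧ ∃ a, IsCanonicalJoinRep A a}
  isRelLowerSet_faces := by
    rintro A ⟨hne, a, ha⟩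
    exact ⟨hne, fun B hBA hB => ⟨hB, ha.subset h hBA hB⟩⟩

end CanonicalJoin

/-! ## The Euler characteristic -/

/-- The number `f_i` of faces of dimension `i`, that is, with `i + 1` vertices. -/
noncomputable def faceNumber {V : Type*} (K : PreAbstractSimplicialComplex V) (i : ℕ) : ℕ :=
  {A : Finset V | A ∈ K ∧ A.card = i + 1}.ncard

/-- The Euler characteristic `∑ i, (-1) ^ i * f_i` of a complex on a finite vertex type; the range
of summation contains all dimensions of faces, since a face has at most `Nat.card V` vertices. -/
noncomputable def eulerChar {V : Type*} [Finite V] (K : PreAbstractSimplicialComplex V) : ℤ :=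
  ∑ i ∈ Finset.range (Nat.card V), (-1) ^ i * (faceNumber K i : ℤ)

/-! ## Northeast paths and the Narayana polynomial -/

namespace AltTamari

variable {n : ℕ}

/-- A northeast path with `n` north steps, starting at the origin, encoded by the numbers of east
steps at each height: `ν` stands for `E^(ν 0) N E^(ν 1) N ⋯ N E^(ν n)`. -/
abbrev NEPath (n : ℕ) : Type := Fin (n + 1) → ℕ

/-- The number of east steps of a path at heights `0, …, y`, which is the largest abscissa of a
point of the path at height `y`. -/
def NEPath.reach (ν : NEPath n) (y : Fin (n + 1)) : ℕ := ∑ i ∈ Finset.Iic y, ν i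

/-- A `ν`-path: a northeast path with the same endpoints as `ν` lying weakly above `ν`. -/
def IsNuPath (ν μ : NEPath n) : Prop :=
  ∑ i, μ i = ∑ i, ν i ∧ ∀ y, μ.reach y ≤ ν.reach y

/-- The number of valleys `EN` of a path, that is, of north steps directly preceded by an east
step. The north step leaving height `i` is so when the path has an east step at height `i`. -/
def NEPath.valleys (μ : NEPath n) : ℕ :=
  (Finset.univ.filter fun i : Fin n => 0 < μ i.castSucc).card

/-- The `ν`-Narayana number: the number of `ν`-paths with exactly `i` valleys. -/
noncomputable def narayana (ν : NEPath n) (i : ℕ) : ℕ :=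
  {μ : NEPath n | IsNuPath ν μ ∧ μ.valleys = i}.ncard

/-- The `ν`-Narayana polynomial. A path with `n` north steps has at most `n` valleys. -/
noncomputable def narayanaPoly (ν : NEPath n) : Polynomial ℤ :=
  ∑ i ∈ Finset.range (n + 1), Polynomial.C (narayana ν i : ℤ) * Polynomial.X ^ i

/-! ## The alt `ν`-Tamari lattice -/

/-- `δ = (δ_1, …, δ_n)` is an increment vector relative to `ν`: `δ_i ≤ ν_i` for `1 ≤ i ≤ n`.
The entry `δ_(i+1)` is `δ i` for `i : Fin n`. -/
def IsIncrementVector (ν : NEPath n) (δ : Fin n → ℕ) : Prop := ∀ i, δ i ≤ ν i.succ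

/-- The path `ν̌ = (∑ ν_i - ∑ δ_i, δ_1, …, δ_n)`. -/
def checkPath (ν : NEPath n) (δ : Fin n → ℕ) : NEPath n :=
  Fin.cons (∑ i, ν i - ∑ i, δ i) δ

/-- The numbers of west steps, height by height, of the northwest path
`ν̂ = W^(ν_0) N W^(ν_1 - δ_1) ⋯ N W^(ν_n - δ_n)`. -/
def hatSteps (ν : NEPath n) (δ : Fin n → ℕ) : Fin (n + 1) → ℕ :=
  Fin.cons (ν 0) fun i => ν i.succ - δ i

/-- The smallest abscissa of a point of `ν̂` at height `y`. The path `ν̂` starts at the lowest right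
corner `(ν̌_0, 0)` of the Ferrers diagram of `ν̌`. -/
def leftBound (ν : NEPath n) (δ : Fin n → ℕ) (y : Fin (n + 1)) : ℕ :=
  checkPath ν δ 0 - ∑ i ∈ Finset.Iic y, hatSteps ν δ i

/-- The largest abscissa of a point of `ν̌` at height `y`. -/
def rightBound (ν : NEPath n) (δ : Fin n → ℕ) (y : Fin (n + 1)) : ℕ := (checkPath ν δ).reach y

/-- Points `(x, y)` of the strip of heights `0, …, n`. -/
abbrev Pt (n : ℕ) : Type := ℕ × Fin (n + 1)

/-- The set `L_{δ,ν}` of lattice points of the diagram `F_{δ,ν}`: the points of the Ferrers diagram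
of `ν̌` which lie weakly above `ν̂`. -/
def latticePoints (ν : NEPath n) (δ : Fin n → ℕ) : Finset (Pt n) :=
  Finset.univ.biUnion fun y =>
    (Finset.Icc (leftBound ν δ y) (rightBound ν δ y)).image fun x => (x, y)

/-- `p` is strictly southwest of `q`, and the smallest rectangle containing both lies in the Ferrers
diagram of `ν̌` (the region weakly above `ν̌` in its bounding rectangle), that is, so does every
point of the rectangle. -/
def SWInside (ν : NEPath n) (δ : Fin n → ℕ) (p q : Pt n) : Prop :=
  p.1 < q.1 ∧ p.2 < q.2 ∧
    ∀ s : Pt n, p.1 ≤ s.1 → s.1 ≤ q.1 → p.2 ≤ s.2 → s.2 ≤ q.2 → s.1 ≤ rightBound ν δ s.2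

/-- Two points are `ν̌`-incompatible. -/
def Incompatible (ν : NEPath n) (δ : Fin n → ℕ) (p q : Pt n) : Prop :=
  SWInside ν δ p q ∨ SWInside ν δ q p

/-- A `(δ,ν)`-tree: a maximal collection of pairwise `ν̌`-compatible points of `L_{δ,ν}`. -/
def IsTree (ν : NEPath n) (δ : Fin n → ℕ) (T : Finset (Pt n)) : Prop :=
  Maximal (fun S : Finset (Pt n) => S ⊆ latticePoints ν δ ∧
    ∀ p ∈ S, ∀ q ∈ S, ¬ Incompatible ν δ p q) T

/-- The set of `(δ,ν)`-trees, the ground set of `Tam_ν(δ)`. -/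
def Tam (ν : NEPath n) (δ : Fin n → ℕ) : Type := {T : Finset (Pt n) // IsTree ν δ T}

variable {ν : NEPath n} {δ : Fin n → ℕ}

/-- `T'` is obtained from `T` by a right rotation: there are nodes `p`, `q`, `r` of `T` with `p`
strictly north of `q` in the same column and `r` strictly east of `q` in the same row, such that the
smallest rectangle containing `p` and `r` contains no other node of `T`, and `T'` arises by
exchanging `q`, the lower left corner of this rectangle, for its upper right corner. -/
def RightRotation (T T' : Tam ν δ) : Prop :=
  ∃ p ∈ T.1, ∃ q ∈ T.1, ∃ r ∈ T.1,
    p.1 = q.1 ∧ q.2 < p.2 ∧ r.2 = q.2 ∧ q.1 < r.1 ∧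
    (∀ s ∈ T.1, p.1 ≤ s.1 → s.1 ≤ r.1 → r.2 ≤ s.2 → s.2 ≤ p.2 → s = p ∨ s = q ∨ s = r) ∧
    T'.1 = insert (r.1, p.2) (T.1.erase q)

/-- A right rotation increases the sum of the coordinates of all nodes. -/
theorem RightRotation.sum_lt {T T' : Tam ν δ} (h : RightRotation T T') :
    ∑ s ∈ T.1, (s.1 + s.2.val) < ∑ s ∈ T'.1, (s.1 + s.2.val) := by
  obtain ⟨p, hp, q, hq, r, hr, h1, h2, h3, h4, h5, h6⟩ := h
  have h2' : q.2.val < p.2.val := h2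
  have hn : (r.1, p.2) ∉ T.1.erase q := by
    intro hm
    rcases h5 _ (Finset.mem_of_mem_erase hm) (by simp; omega) le_rfl
      (by rw [h3]; exact h2.le) le_rfl with e | e | e
    · have := congrArg Prod.fst e
      simp at this; omega
    · have := congrArg Prod.fst e
      simp at this; omega
    · have := congrArg (fun t : Pt n => t.2.val) e
      simp [h3] at this; omega
  have e : ∑ s ∈ T.1, (s.1 + s.2.val) = (q.1 + q.2.val) + ∑ s ∈ T.1.erase q, (s.1 + s.2.val) :=
    (Finset.add_sum_erase T.1 (fun s : Pt n => s.1 + s.2.val) hq).symm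
  have e' : ∑ s ∈ T'.1, (s.1 + s.2.val) =
      (r.1 + p.2.val) + ∑ s ∈ T.1.erase q, (s.1 + s.2.val) := by
    rw [h6]
    exact Finset.sum_insert (f := fun s : Pt n => s.1 + s.2.val) hn
  rw [e, e']
  omega

/-- The rotation order: `T ≤ T'` when `T'` is obtained from `T` by a sequence of right rotations. -/
instance : PartialOrder (Tam ν δ) where
  le := Relation.ReflTransGen RightRotation
  le_refl _ := Relation.ReflTransGen.refl
  le_trans _ _ _ := Relation.ReflTransGen.trans
  le_antisymm T T' h h' := by
    have key : ∀ {A B : Tam ν δ}, Relation.ReflTransGen RightRotation A B →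
        A = B ∨ ∑ s ∈ A.1, (s.1 + s.2.val) < ∑ s ∈ B.1, (s.1 + s.2.val) := by
      intro A B hAB
      induction hAB with
      | refl => exact Or.inl rfl
      | tail _ hr ih =>
        rcases ih with rfl | ih
        · exact Or.inr hr.sum_lt
        · exact Or.inr (ih.trans hr.sum_lt)
    rcases key h with e | e
    · exact e
    · rcases key h' with e' | e'
      · exact e'.symm
      · exact absurd e (not_lt.2 e'.le)

instance : Finite (Tam ν δ) :=
  Finite.of_injective
    (fun T : Tam ν δ =>
      (⟨T.1, Finset.mem_powerset.2 T.2.prop.1⟩ : (latticePoints ν δ).powerset))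
    fun _ _ h => Subtype.ext (congrArg (fun t => t.1) h)

end AltTamari

/-! ### Canonical join representations read off from labelled covers -/

namespace CanonicalJoin

section Semidistributive

variable {P : Type*} [Lattice P]

/-! A `(δ,ν)`-tree is determined by the function `c` giving the height of the topmost node of each
column. Under this encoding (`heightIso`) the rotation order becomes the pointwise order on
functions satisfying `IsHeight`. These are closed under pointwise minimum and have a top, so they
form a lattice. A rotation changes one value only: for each non-maximal value `y` of `c` exactly one
column of height `y` can be raised, so the upper covers of `c` are counted by its non-maximal values
(`HeightFn.card_upperCovers`).

Counting columns by height turns `c` into a `ν`-path whose valleys are the non-maximal values of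
`c`. This is a bijection because row `y` of the diagram has `ν.reach y + 1` points whatever `δ` is
(`rightBound_eq`). So `N_ν(t)` is the sum of `t` to the number of upper covers.

The lattice is semidistributive: every cover carries a least element that separates it from below
and a greatest one from above. The least ones, over the lower covers of `a`, form the canonical join
representation of `a`, so the complex is counted by lower covers. It remains to trade lower for
upper covers. The pairs of labels below an element form a set described by a self-dual condition
(`IsKappaFlag`), and all such sets arise, so the dual lattice has the same ones up to a swap. -/

theorem IsCanonicalJoinRep.unique {A B : Finset P} {a : P} (hA : IsCanonicalJoinRep A a)
    (hB : IsCanonicalJoinRep B a) : A = B := by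
  classical
  have key : ∀ {A B : Finset P}, IsCanonicalJoinRep A a → IsCanonicalJoinRep B a → A ⊆ B := by
    intro A B hA hB x hx
    obtain ⟨y, hy, hxy⟩ := hA.2.2 B hB.1 x hx
    obtain ⟨z, hz, hyz⟩ := hB.2.2 A hA.1 y hy
    by_cases hzx : z = x
    · subst hzx
      rwa [le_antisymm hxy hyz]
    -- Here `x ≤ z` for another element `z` of `A`, so `x` could be dropped.
    · exfalso
      refine hA.2.1 (A.erase x) (Finset.erase_ssubset hx)
        ⟨fun j hj => hA.1.1 j (Finset.mem_of_mem_erase hj), ?_, ?_⟩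
      · exact fun w hw => hA.1.2.1 (Finset.mem_of_mem_erase (Finset.mem_coe.1 hw))
      · intro u hu
        refine hA.1.2.2 fun w hw => ?_
        by_cases hwx : w = x
        · subst hwx
          exact (hxy.trans hyz).trans (hu (Finset.mem_coe.2 (Finset.mem_erase.2 ⟨hzx, hz⟩)))
        · exact hu (Finset.mem_coe.2 (Finset.mem_erase.2 ⟨hwx, hw⟩))
  exact (key hA hB).antisymm (key hB hA)

variable [Fintype P] [DecidableEq P]

open Classical in
/-- The elements covered by `a`. -/
noncomputable def lowerCovers (a : P) : Finset P := Finset.univ.filter (· ⋖ a)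

omit [DecidableEq P] in
@[simp] theorem mem_lowerCovers {a c : P} : c ∈ lowerCovers a ↔ c ⋖ a := by
  simp [lowerCovers]

/-- The labels of the covers below `a`, for a labelling `J` of covers. -/
noncomputable def lowerLabels (J : P → P → P) (a : P) : Finset P :=
  (lowerCovers a).image fun c => J c a

/-- `J` labels each cover `c ⋖ a` by the least element below `a` and not below `c`. -/
def IsJoinLabelling (J : P → P → P) : Prop :=
  ∀ c a, c ⋖ a → IsLeast {x | x ≤ a ∧ ¬ x ≤ c} (J c a)

/-- `M` labels each cover `c ⋖ a` by the greatest element above `c` and not above `a`. -/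
def IsMeetLabelling (M : P → P → P) : Prop :=
  ∀ c a, c ⋖ a → IsGreatest {x | c ≤ x ∧ ¬ a ≤ x} (M c a)

omit [Fintype P] [DecidableEq P] in
theorem exists_isJoinLabelling
    (h : ∀ c a : P, c ⋖ a → ∃ j, IsLeast {x | x ≤ a ∧ ¬ x ≤ c} j) :
    ∃ J : P → P → P, IsJoinLabelling J := by
  classical
  choose! J hJ using h
  exact ⟨J, hJ⟩

omit [Fintype P] [DecidableEq P] in
theorem exists_isMeetLabelling
    (h : ∀ c a : P, c ⋖ a → ∃ m, IsGreatest {x | c ≤ x ∧ ¬ a ≤ x} m) :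
    ∃ M : P → P → P, IsMeetLabelling M := by
  classical
  choose! M hM using h
  exact ⟨M, hM⟩

namespace IsJoinLabelling

variable {J : P → P → P} (hJ : IsJoinLabelling J)
include hJ

omit [Fintype P] [DecidableEq P] in
theorem le_of_lt {c a x : P} (h : c ⋖ a) (hx : x < J c a) : x ≤ c := by
  by_contra hc
  exact hx.not_ge ((hJ c a h).2 ⟨hx.le.trans (hJ c a h).1.1, hc⟩)

omit [Fintype P] [DecidableEq P] in
-- Distinct lower covers of `a` are incomparable, so `c` competes in the set whose minimum is `J c'
-- a`.
theorem le_of_ne {c c' a : P} (h : c ⋖ a) (h' : c' ⋖ a) (hne : c ≠ c') : J c' a ≤ c := by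
  refine (hJ c' a h').2 ⟨h.le, fun hcc => ?_⟩
  exact h.2 (lt_of_le_of_ne hcc hne) h'.lt

omit [Fintype P] [DecidableEq P] in
theorem injOn (a : P) : Set.InjOn (fun c => J c a) {c | c ⋖ a} := by
  intro c hc c' hc' he
  by_contra hne
  have h1 := hJ.le_of_ne hc hc' hne
  simp only at he
  rw [← he] at h1
  exact (hJ c a hc).1.2 h1

theorem card_lowerLabels (a : P) : (lowerLabels J a).card = (lowerCovers a).card := by
  refine Finset.card_image_of_injOn fun c hc c' hc' he => hJ.injOn a ?_ ?_ he
  · simpa using hc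
  · simpa using hc'

omit [Fintype P] [DecidableEq P] in
-- By minimality everything strictly below `J c a` is below `c`, so `J c a ⊓ c` is its only lower
-- cover.
theorem joinIrr {c a : P} (h : c ⋖ a) : JoinIrr (J c a) := by
  have h0 : J c a ⊓ c < J c a := lt_of_le_of_ne inf_le_left fun e =>
    (hJ c a h).1.2 (inf_eq_left.1 e)
  refine ⟨J c a ⊓ c, ⟨h0, fun x hx hx' => ?_⟩, fun x hx => ?_⟩
  · exact hx.not_ge (le_inf hx'.le (hJ.le_of_lt h hx'))
  · have hle : x ≤ J c a ⊓ c := le_inf hx.le (hJ.le_of_lt h hx.lt)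
    rcases hle.lt_or_eq with hlt | he
    · exact absurd h0 (hx.2 hlt)
    · exact he

omit hJ [DecidableEq P] in
theorem isLUB_of_forall {a : P} {S : Set P} (hS : ∀ x ∈ S, x ≤ a)
    (hS' : ∀ c, c ⋖ a → ∃ x ∈ S, ¬ x ≤ c) : IsLUB S a := by
  refine ⟨hS, fun u hu => ?_⟩
  by_contra hau
  have hlt : a ⊓ u < a := lt_of_le_of_ne inf_le_left fun e => hau (inf_eq_left.1 e)
  obtain ⟨c, hc1, hc2⟩ := exists_le_covBy_of_lt hlt
  obtain ⟨x, hx, hxc⟩ := hS' c hc2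
  exact hxc ((le_inf (hS x hx) (hu hx)).trans hc1)

/-- A join-representation of `a` must leave each lower cover `c`, hence has an element above `J c
a`. No label is redundant: `J c a` is not below `c`, while the labels of all other covers are. -/
theorem isCanonicalJoinRep (a : P) : IsCanonicalJoinRep (lowerLabels J a) a := by
  have href : ∀ B, IsJoinRep B a → Refines (lowerLabels J a) B := by
    intro B hB x hx
    obtain ⟨c, hc, rfl⟩ := Finset.mem_image.1 hx
    rw [mem_lowerCovers] at hc
    by_contra! hcon
    refine hc.lt.not_ge (hB.2.2 fun b hb => ?_)
    by_contra hbc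
    exact hcon b hb ((hJ c a hc).2 ⟨hB.2.1 hb, hbc⟩)
  refine ⟨⟨?_, isLUB_of_forall ?_ ?_⟩, ?_, href⟩
  · intro j hj
    obtain ⟨c, hc, rfl⟩ := Finset.mem_image.1 hj
    exact hJ.joinIrr (mem_lowerCovers.1 hc)
  · intro x hx
    obtain ⟨c, hc, rfl⟩ := Finset.mem_image.1 (Finset.mem_coe.1 hx)
    exact (hJ c a (mem_lowerCovers.1 hc)).1.1
  · exact fun c hc => ⟨J c a, Finset.mem_coe.2 (Finset.mem_image.2 ⟨c, mem_lowerCovers.2 hc, rfl⟩),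
      (hJ c a hc).1.2⟩
  · intro B hB hBa
    obtain ⟨x, hx, hxB⟩ := (Finset.ssubset_iff_of_subset hB.1).1 hB
    obtain ⟨y, hy, hxy⟩ := href B hBa x hx
    obtain ⟨c, hc, rfl⟩ := Finset.mem_image.1 hx
    obtain ⟨c', hc', rfl⟩ := Finset.mem_image.1 (hB.1 hy)
    rw [mem_lowerCovers] at hc hc'
    have hne : c ≠ c' := by
      rintro rfl
      exact hxB hy
    exact (hJ c a hc).1.2 (hxy.trans (hJ.le_of_ne hc hc' hne))

theorem injective_lowerLabels : Function.Injective (lowerLabels J) := fun a b h =>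
  (hJ.isCanonicalJoinRep a).1.2.unique (h ▸ (hJ.isCanonicalJoinRep b).1.2)

theorem faceNumber_canonicalJoinComplex (h : IsLatticeOrder P) (i : ℕ) :
    faceNumber (canonicalJoinComplex h) i =
      (Finset.univ.filter fun a : P => (lowerCovers a).card = i + 1).card := by
  have e : {A : Finset P | A ∈ canonicalJoinComplex h ∧ A.card = i + 1} =
      lowerLabels J '' {a | (lowerCovers a).card = i + 1} := by
    ext A
    constructor
    · rintro ⟨⟨-, a, ha⟩, hc⟩
      have hA := ha.unique (hJ.isCanonicalJoinRep a)
      refine ⟨a, ?_, hA.symm⟩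
      rw [Set.mem_ofPred_eq, ← hJ.card_lowerLabels, ← hA, hc]
    · rintro ⟨a, ha, rfl⟩
      have hc : (lowerLabels J a).card = i + 1 := by rw [hJ.card_lowerLabels]; exact ha
      exact ⟨⟨Finset.card_pos.1 (by omega), a, hJ.isCanonicalJoinRep a⟩, hc⟩
  rw [faceNumber, e, Set.ncard_image_of_injective _ hJ.injective_lowerLabels,
    ← Set.ncard_coe_finset]
  congr 1
  ext a
  simp

/-- The summand 1 compensates for the minimum, the only element without lower covers: its canonical
join representation is empty and hence not a face. -/
theorem eulerChar_eq_sum_lowerCovers [Nonempty P] (h : IsLatticeOrder P) :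
    eulerChar (canonicalJoinComplex h) = 1 - ∑ a : P, (-1) ^ (lowerCovers a).card := by
  have hbot : ∃ b : P, ∀ x, b ≤ x := by
    have : (Finset.univ : Finset P).Nonempty := Finset.univ_nonempty
    exact ⟨Finset.univ.inf' this id, fun x => Finset.inf'_le id (Finset.mem_univ x)⟩
  obtain ⟨b, hb⟩ := hbot
  have h1 : ∑ a : P, (if (lowerCovers a).card = 0 then (1 : ℤ) else 0) = 1 := by
    rw [Finset.sum_eq_single b, if_pos]
    · rw [Finset.card_eq_zero, Finset.eq_empty_iff_forall_notMem]
      intro c hc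
      exact (mem_lowerCovers.1 hc).lt.not_ge (hb c)
    · intro a _ hab
      rw [if_neg]
      obtain ⟨c, -, hc⟩ := exists_le_covBy_of_lt (lt_of_le_of_ne (hb a) hab.symm)
      exact (Finset.card_pos.2 ⟨c, mem_lowerCovers.2 hc⟩).ne'
    · exact fun h => absurd (Finset.mem_univ b) h
  have h2 : 1 - ∑ a : P, (-1 : ℤ) ^ (lowerCovers a).card = ∑ a : P,
      ((if (lowerCovers a).card = 0 then 1 else 0) - (-1) ^ (lowerCovers a).card) := by
    rw [Finset.sum_sub_distrib, h1]
  rw [eulerChar, h2]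
  simp_rw [hJ.faceNumber_canonicalJoinComplex h, Finset.card_filter, Nat.cast_sum, Finset.mul_sum]
  rw [Finset.sum_comm]
  refine Finset.sum_congr rfl fun a _ => ?_
  have hle : (lowerCovers a).card ≤ Nat.card P := by
    rw [Nat.card_eq_fintype_card]
    exact Finset.card_le_univ _
  rcases hk : (lowerCovers a).card with _ | k
  · simp
  · rw [Finset.sum_eq_single k]
    · simp [pow_succ]
    · intro i _ hi
      rw [if_neg (by omega)]
      simp
    · intro hk'
      rw [Finset.mem_range] at hk'
      omega

end IsJoinLabelling

/-! ### Kappa pairs: a self-dual description of the labels below an element -/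

/-- A pair `(j, m)` with `j` not below `m`, such that everything strictly below `j` is below `m` and
everything strictly above `m` is above `j`. -/
def IsKappaPair (p : P × P) : Prop :=
  ¬ p.1 ≤ p.2 ∧ (∀ x, x < p.1 → x ≤ p.2) ∧ ∀ x, p.2 < x → p.1 ≤ x

/-- A set of kappa pairs in which each first entry is below all other second entries. -/
def IsKappaFlag (F : Finset (P × P)) : Prop :=
  (∀ p ∈ F, IsKappaPair p) ∧ ∀ p ∈ F, ∀ q ∈ F, p ≠ q → p.1 ≤ q.2

section Kappa

variable {J M : P → P → P}

omit [Fintype P] [DecidableEq P] in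
theorem isKappaPair_label (hJ : IsJoinLabelling J) (hM : IsMeetLabelling M) {c a : P}
    (h : c ⋖ a) : IsKappaPair (J c a, M c a) := by
  have hj := hJ c a h
  have hm := hM c a h
  refine ⟨fun hle => ?_, fun x hx => (hJ.le_of_lt h hx).trans hm.1.1, fun x hx => ?_⟩
  -- The cover forces `c ⊔ J c a = a`, so `J c a ≤ M c a` would put `a` below `M c a`.
  · have h1 : c < c ⊔ J c a := lt_of_le_of_ne le_sup_left fun e =>
      hj.1.2 (sup_eq_left.1 e.symm)
    have h2 : c ⊔ J c a ≤ a := sup_le h.le hj.1.1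
    have h3 : c ⊔ J c a = a := by
      rcases h2.lt_or_eq with h2 | h2
      · exact absurd h2 (h.2 h1)
      · exact h2
    exact hm.1.2 (h3.ge.trans (sup_le hm.1.1 hle))
  · by_contra hjx
    exact hx.not_ge (hm.2 ⟨hm.1.1.trans hx.le, fun hax => hjx (hj.1.1.trans hax)⟩)

omit [Fintype P] [DecidableEq P] in
-- Both candidates must be the meet label of the cover `m ⊓ j ⋖ j`: each lies below that label, and
-- anything strictly larger than it would be above `j`.
theorem IsKappaPair.snd_eq (hM : IsMeetLabelling M) {j m m' : P} (h : IsKappaPair (j, m))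
    (h' : IsKappaPair (j, m')) : m = m' := by
  have h0 : m ⊓ j < j := lt_of_le_of_ne inf_le_right fun e => h.1 (inf_eq_right.1 e)
  have hc : m ⊓ j ⋖ j := ⟨h0, fun x hx hx' => hx.not_ge (le_inf (h.2.1 x hx') hx'.le)⟩
  have hm := hM _ _ hc
  have key : ∀ {k}, IsKappaPair (j, k) → k = M (m ⊓ j) j := by
    intro k hk
    have h1 : k ≤ M (m ⊓ j) j := hm.2 ⟨hk.2.1 _ h0, hk.1⟩
    rcases h1.lt_or_eq with h1 | h1
    · exact absurd (hk.2.2 _ h1) hm.1.2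
    · exact h1
  rw [key h, key h']

variable (J M) in
/-- The pairs of labels of the covers below `a`. -/
noncomputable def lowerPairs (a : P) : Finset (P × P) :=
  (lowerCovers a).image fun c => (J c a, M c a)

theorem image_fst_lowerPairs (a : P) : (lowerPairs J M a).image Prod.fst = lowerLabels J a := by
  rw [lowerPairs, lowerLabels, Finset.image_image]
  rfl

theorem card_lowerPairs (hJ : IsJoinLabelling J) (a : P) :
    (lowerPairs J M a).card = (lowerCovers a).card := by
  refine Finset.card_image_of_injOn fun c hc c' hc' he => hJ.injOn a ?_ ?_ (congrArg Prod.fst he)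
  · simpa using hc
  · simpa using hc'

theorem isKappaFlag_lowerPairs (hJ : IsJoinLabelling J) (hM : IsMeetLabelling M) (a : P) :
    IsKappaFlag (lowerPairs J M a) := by
  constructor
  · intro p hp
    obtain ⟨c, hc, rfl⟩ := Finset.mem_image.1 hp
    exact isKappaPair_label hJ hM (mem_lowerCovers.1 hc)
  · intro p hp q hq hpq
    obtain ⟨c, hc, rfl⟩ := Finset.mem_image.1 hp
    obtain ⟨c', hc', rfl⟩ := Finset.mem_image.1 hq
    rw [mem_lowerCovers] at hc hc'
    have hne : c' ≠ c := by
      rintro rfl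
      exact hpq rfl
    exact (hJ.le_of_ne hc' hc hne).trans (hM c' a hc').1.1

theorem exists_lowerPairs_eq [Nonempty P] (hJ : IsJoinLabelling J) (hM : IsMeetLabelling M)
    {F : Finset (P × P)} (hF : IsKappaFlag F) : ∃ a, lowerPairs J M a = F := by
  have hbot : ∃ b : P, ∀ x, b ≤ x := by
    have : (Finset.univ : Finset P).Nonempty := Finset.univ_nonempty
    exact ⟨Finset.univ.inf' this id, fun x => Finset.inf'_le id (Finset.mem_univ x)⟩
  obtain ⟨b, hb⟩ := hbot
  let : OrderBot P := { bot := b, bot_le := hb }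
  set a := F.sup Prod.fst with ha
  have hle : ∀ p ∈ F, p.1 ≤ a := fun p hp => Finset.le_sup (f := Prod.fst) hp
  have hsub : ∀ p ∈ F, ∃ c, c ⋖ a ∧ J c a = p.1 := by
    intro p hp
    have hk := hF.1 p hp
    -- All joinands lie below `p.2`, so `c₀` is not above `p.1`. A lower cover of `a` above `c₀`
    -- contains the other first entries and everything strictly below `p.1`, which forces its label
    -- to be `p.1`.
    set c₀ := (p.1 ⊓ p.2) ⊔ (F.erase p).sup Prod.fst with hc₀
    have h1 : c₀ ≤ p.2 := by
      refine sup_le inf_le_right (Finset.sup_le fun q hq => ?_)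
      exact hF.2 q (Finset.mem_of_mem_erase hq) p hp (Finset.ne_of_mem_erase hq)
    have h2 : c₀ ≤ a := by
      refine sup_le (inf_le_left.trans (hle p hp)) (Finset.sup_le fun q hq => ?_)
      exact hle q (Finset.mem_of_mem_erase hq)
    have h3 : c₀ < a := lt_of_le_of_ne h2 fun e => hk.1 ((hle p hp).trans (e ▸ h1))
    obtain ⟨c, hc1, hc2⟩ := exists_le_covBy_of_lt h3
    have h4 : ¬ p.1 ≤ c := by
      intro hpc
      refine hc2.lt.not_ge (Finset.sup_le fun q hq => ?_)
      by_cases hqp : q = p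
      · exact hqp ▸ hpc
      · exact ((Finset.le_sup (f := Prod.fst) (Finset.mem_erase.2 ⟨hqp, hq⟩)).trans
          le_sup_right).trans hc1
    have h5 : J c a ≤ p.1 := (hJ c a hc2).2 ⟨hle p hp, h4⟩
    refine ⟨c, hc2, ?_⟩
    rcases h5.lt_or_eq with h5 | h5
    · exact absurd (((le_inf h5.le (hk.2.1 _ h5)).trans le_sup_left).trans hc1)
        (hJ c a hc2).1.2
    · exact h5
  have hsub' : F ⊆ lowerPairs J M a := by
    intro p hp
    obtain ⟨c, hc, he⟩ := hsub p hp
    refine Finset.mem_image.2 ⟨c, mem_lowerCovers.2 hc, ?_⟩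
    have h1 := isKappaPair_label hJ hM hc
    rw [he] at h1
    have h2 := h1.snd_eq hM (hF.1 p hp)
    exact Prod.ext he h2
  refine ⟨a, (Finset.Subset.antisymm hsub' ?_).symm⟩
  intro p hp
  obtain ⟨c, hc, rfl⟩ := Finset.mem_image.1 hp
  rw [mem_lowerCovers] at hc
  -- All first entries of `F` would be labels of covers other than `c`, hence below `c`, and so
  -- would be their join `a`.
  by_contra hcF
  refine hc.lt.not_ge (Finset.sup_le fun q hq => ?_)
  obtain ⟨c', hc', he⟩ := hsub q hq
  rw [← he]
  refine hJ.le_of_ne hc hc' ?_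
  rintro rfl
  obtain ⟨c'', hc'', he'⟩ := Finset.mem_image.1 (hsub' hq)
  rw [mem_lowerCovers] at hc''
  have : c'' = c := hJ.injOn a hc'' hc (by simp only; rw [he, ← he'])
  subst this
  exact hcF (he' ▸ hq)

open Classical in
theorem sum_lowerCovers_eq_sum_isKappaFlag [Nonempty P] (hJ : IsJoinLabelling J)
    (hM : IsMeetLabelling M) :
    ∑ a : P, (-1 : ℤ) ^ (lowerCovers a).card =
      ∑ F : Finset (P × P) with IsKappaFlag F, (-1 : ℤ) ^ F.card := by
  refine Finset.sum_bij (fun a _ => lowerPairs J M a) ?_ ?_ ?_ ?_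
  · exact fun a _ => Finset.mem_filter.2 ⟨Finset.mem_univ _, isKappaFlag_lowerPairs hJ hM a⟩
  · intro a _ b _ h
    refine hJ.injective_lowerLabels ?_
    rw [← image_fst_lowerPairs (M := M), ← image_fst_lowerPairs (M := M), h]
  · intro F hF
    obtain ⟨a, ha⟩ := exists_lowerPairs_eq hJ hM (Finset.mem_filter.1 hF).2
    exact ⟨a, Finset.mem_univ _, ha⟩
  · intro a _
    rw [card_lowerPairs hJ]

end Kappa

/-! ### Lower covers against upper covers, by duality -/

omit [Fintype P] [DecidableEq P] in
open OrderDual in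
theorem IsMeetLabelling.dual {M : P → P → P} (hM : IsMeetLabelling M) :
    IsJoinLabelling (P := Pᵒᵈ) fun c a => toDual (M (ofDual a) (ofDual c)) :=
  fun c a h => hM (ofDual a) (ofDual c) h.ofDual

omit [Fintype P] [DecidableEq P] in
open OrderDual in
theorem IsJoinLabelling.dual {J : P → P → P} (hJ : IsJoinLabelling J) :
    IsMeetLabelling (P := Pᵒᵈ) fun c a => toDual (J (ofDual a) (ofDual c)) :=
  fun c a h => hJ (ofDual a) (ofDual c) h.ofDual

open Classical OrderDual in
/-- In a finite semidistributive lattice, the numbers of lower and of upper covers are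
equidistributed; in particular the alternating sums agree. -/
theorem sum_lowerCovers_eq_sum_upperCovers [Nonempty P] {J M : P → P → P}
    (hJ : IsJoinLabelling J) (hM : IsMeetLabelling M) :
    ∑ a : P, (-1 : ℤ) ^ (lowerCovers a).card =
      ∑ a : P, (-1 : ℤ) ^ (Finset.univ.filter fun b => a ⋖ b).card := by
  have h1 : ∑ a : P, (-1 : ℤ) ^ (Finset.univ.filter fun b => a ⋖ b).card =
      ∑ a : Pᵒᵈ, (-1 : ℤ) ^ (lowerCovers a).card := by
    refine Fintype.sum_equiv toDual _ _ fun a => ?_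
    congr 1
    refine Finset.card_bij (fun b _ => toDual b) ?_ ?_ ?_
    · intro b hb
      rw [mem_lowerCovers]
      exact (Finset.mem_filter.1 hb).2.toDual
    · exact fun b _ c _ h => h
    · intro b hb
      rw [mem_lowerCovers] at hb
      exact ⟨ofDual b, Finset.mem_filter.2 ⟨Finset.mem_univ _, hb.ofDual⟩, rfl⟩
  rw [h1, sum_lowerCovers_eq_sum_isKappaFlag hJ hM,
    sum_lowerCovers_eq_sum_isKappaFlag hM.dual hJ.dual]
  -- Reversing `(j, m)` exchanges the last two conditions of a kappa pair, and the flag condition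
  -- ranges over ordered pairs in both orders.
  have hswap : ∀ F : Finset (P × P), IsKappaFlag F →
      IsKappaFlag (P := Pᵒᵈ) (F.image fun p => (toDual p.2, toDual p.1)) := by
    intro F hF
    constructor
    · intro p hp
      obtain ⟨q, hq, rfl⟩ := Finset.mem_image.1 hp
      have := hF.1 q hq
      exact ⟨this.1, this.2.2, this.2.1⟩
    · intro p hp p' hp' hne
      obtain ⟨q, hq, rfl⟩ := Finset.mem_image.1 hp
      obtain ⟨q', hq', rfl⟩ := Finset.mem_image.1 hp'
      refine hF.2 q' hq' q hq ?_
      rintro rfl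
      exact hne rfl
  have hswap' : ∀ F : Finset (Pᵒᵈ × Pᵒᵈ), IsKappaFlag F →
      IsKappaFlag (P := P) (F.image fun p => (ofDual p.2, ofDual p.1)) := by
    intro F hF
    constructor
    · intro p hp
      obtain ⟨q, hq, rfl⟩ := Finset.mem_image.1 hp
      have := hF.1 q hq
      exact ⟨this.1, this.2.2, this.2.1⟩
    · intro p hp p' hp' hne
      obtain ⟨q, hq, rfl⟩ := Finset.mem_image.1 hp
      obtain ⟨q', hq', rfl⟩ := Finset.mem_image.1 hp'
      refine hF.2 q' hq' q hq ?_
      rintro rfl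
      exact hne rfl
  refine Finset.sum_bij' (fun F _ => F.image fun p => (toDual p.2, toDual p.1))
    (fun F _ => F.image fun p => (ofDual p.2, ofDual p.1)) ?_ ?_ ?_ ?_ ?_
  · exact fun F hF => Finset.mem_filter.2 ⟨Finset.mem_univ _, hswap F (Finset.mem_filter.1 hF).2⟩
  · exact fun F hF => Finset.mem_filter.2 ⟨Finset.mem_univ _, hswap' F (Finset.mem_filter.1 hF).2⟩
  · intro F _
    rw [Finset.image_image]
    exact Finset.image_id
  · intro F _
    rw [Finset.image_image]
    exact Finset.image_id
  · intro F _
    rw [Finset.card_image_of_injective]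
    rintro ⟨a, b⟩ ⟨c, d⟩ h
    exact Prod.ext (congrArg Prod.snd h) (congrArg Prod.fst h)

end Semidistributive

end CanonicalJoin

/-- A nonempty down-directed subset of a finite order has a least element. -/
theorem exists_isLeast_of_directed {P : Type*} [PartialOrder P] [Finite P] {S : Set P}
    (hne : S.Nonempty) (hS : ∀ x ∈ S, ∀ y ∈ S, ∃ w ∈ S, w ≤ x ∧ w ≤ y) : ∃ x, IsLeast S x := by
  obtain ⟨m, hm⟩ := S.toFinite.exists_minimal hne
  refine ⟨m, hm.prop, fun x hx => ?_⟩
  obtain ⟨w, hw, h1, h2⟩ := hS m hm.prop x hx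
  exact (hm.le_of_le hw h1).trans h2

namespace AltTamari

variable {n : ℕ} {ν : NEPath n} {δ : Fin n → ℕ}

/-! ### Shape of the diagram -/

section Bounds

theorem rightBound_mono : Monotone (rightBound ν δ) := fun _ _ h =>
  Finset.sum_le_sum_of_subset (Finset.Iic_subset_Iic.2 h)

theorem leftBound_anti : Antitone (leftBound ν δ) := fun _ _ h =>
  Nat.sub_le_sub_left (Finset.sum_le_sum_of_subset (Finset.Iic_subset_Iic.2 h)) _

theorem IsIncrementVector.sum_hatSteps (hδ : IsIncrementVector ν δ) :
    ∑ i, hatSteps ν δ i = checkPath ν δ 0 := by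
  have h := Finset.sum_tsub_distrib Finset.univ fun i _ => hδ i
  have h' : ∑ i, δ i ≤ ∑ i : Fin n, ν i.succ := Finset.sum_le_sum fun i _ => hδ i
  simp only [hatSteps, checkPath, Fin.sum_univ_succ, Fin.cons_zero, Fin.cons_succ]
  rw [h]
  omega

theorem IsIncrementVector.leftBound_last (hδ : IsIncrementVector ν δ) :
    leftBound ν δ (Fin.last n) = 0 := by
  have : Finset.Iic (Fin.last n) = Finset.univ := by
    ext i
    simp [Fin.le_last]
  rw [leftBound, this, hδ.sum_hatSteps, Nat.sub_self]

/-- At each height above 0 the steps of `ν̌` and `ν̂` add up to that of `ν`. Hence row lengths do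
not depend on `δ`, the source of the independence in the final claim. -/
theorem IsIncrementVector.rightBound_eq (hδ : IsIncrementVector ν δ) (y : Fin (n + 1)) :
    rightBound ν δ y = leftBound ν δ y + ν.reach y := by
  have h1 : ∑ i ∈ Finset.Iic y, hatSteps ν δ i ≤ checkPath ν δ 0 := by
    rw [← hδ.sum_hatSteps]
    exact Finset.sum_le_sum_of_subset (Finset.subset_univ _)
  have h2 : rightBound ν δ y + ∑ i ∈ Finset.Iic y, hatSteps ν δ i =
      checkPath ν δ 0 + ν.reach y := by
    have h0 : (0 : Fin (n + 1)) ∈ Finset.Iic y := by simp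
    rw [rightBound, NEPath.reach, NEPath.reach, ← Finset.add_sum_erase _ _ h0,
      ← Finset.add_sum_erase _ (hatSteps ν δ) h0, ← Finset.add_sum_erase _ ν h0]
    have : ∑ x ∈ (Finset.Iic y).erase 0, checkPath ν δ x +
        ∑ x ∈ (Finset.Iic y).erase 0, hatSteps ν δ x = ∑ x ∈ (Finset.Iic y).erase 0, ν x := by
      rw [← Finset.sum_add_distrib]
      refine Finset.sum_congr rfl fun i hi => ?_
      obtain ⟨j, rfl⟩ := Fin.exists_succ_eq.2 (Finset.ne_of_mem_erase hi)
      have := hδ j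
      simp only [checkPath, hatSteps, Fin.cons_succ]
      omega
    simp only [hatSteps, Fin.cons_zero] at this ⊢
    omega
  rw [leftBound]
  omega

theorem IsIncrementVector.leftBound_le_rightBound (hδ : IsIncrementVector ν δ)
    (y : Fin (n + 1)) : leftBound ν δ y ≤ rightBound ν δ y := by
  rw [hδ.rightBound_eq]
  exact Nat.le_add_right _ _

theorem IsIncrementVector.rightBound_last (hδ : IsIncrementVector ν δ) :
    rightBound ν δ (Fin.last n) = ∑ i, ν i := by
  have : Finset.Iic (Fin.last n) = Finset.univ := by
    ext i
    simp [Fin.le_last]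
  rw [hδ.rightBound_eq, hδ.leftBound_last, zero_add, NEPath.reach, this]

theorem mem_latticePoints {p : Pt n} :
    p ∈ latticePoints ν δ ↔ leftBound ν δ p.2 ≤ p.1 ∧ p.1 ≤ rightBound ν δ p.2 := by
  simp only [latticePoints, Finset.mem_biUnion, Finset.mem_univ, true_and, Finset.mem_image,
    Finset.mem_Icc]
  constructor
  · rintro ⟨y, x, h, rfl⟩
    exact h
  · exact fun h => ⟨p.2, p.1, h, rfl⟩

/-- Rows get longer upwards on the right, so only the lower right corner of the rectangle matters.
-/
theorem swInside_iff {p q : Pt n} :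
    SWInside ν δ p q ↔ p.1 < q.1 ∧ p.2 < q.2 ∧ q.1 ≤ rightBound ν δ p.2 := by
  refine and_congr_right fun h1 => and_congr_right fun h2 => ⟨fun h => ?_, fun h s _ hs hs' _ => ?_⟩
  · exact h (q.1, p.2) h1.le le_rfl le_rfl h2.le
  · exact hs.trans (h.trans (rightBound_mono hs'))

end Bounds

/-! ### Height functions -/

variable (ν δ) in
/-- The functions which record the height of the topmost node of each column of a
`(δ,ν)`-tree, extended by the maximal height. -/
def IsHeight (c : ℕ → Fin (n + 1)) : Prop :=
  (∀ x, c x ≠ Fin.last n → leftBound ν δ (c x) < x ∧ x ≤ rightBound ν δ (c x)) ∧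
    ∀ x x', x < x' → x' ≤ rightBound ν δ (c x) → c x' ≤ c x

variable (ν δ) in
/-- The poset of height functions, ordered pointwise. -/
abbrev HeightFn : Type := {c : ℕ → Fin (n + 1) // IsHeight ν δ c}

variable (ν δ) in
/-- `p` is a node of the tree with height function `c`. -/
def IsNode (c : ℕ → Fin (n + 1)) (p : Pt n) : Prop :=
  p.1 ≤ rightBound ν δ p.2 ∧ p.2 ≤ c p.1 ∧
    ∀ x, p.1 < x → x ≤ rightBound ν δ p.2 → c x ≤ p.2

variable (ν δ) in
open Classical in
/-- The tree with height function `c`. -/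
noncomputable def treeOf (c : ℕ → Fin (n + 1)) : Finset (Pt n) :=
  (latticePoints ν δ).filter (IsNode ν δ c)

namespace IsHeight

variable {c d : ℕ → Fin (n + 1)}

/-- At each `x` the minimum equals one of the two functions, and the conditions on that function at
`x` also bound the minimum. -/
theorem inf (hc : IsHeight ν δ c) (hd : IsHeight ν δ d) : IsHeight ν δ (c ⊓ d) := by
  constructor
  · intro x
    rcases min_choice (c x) (d x) with h | h <;> simp only [Pi.inf_apply, h]
    · exact hc.1 x
    · exact hd.1 x
  · intro x x' hx hx'
    simp only [Pi.inf_apply] at hx' ⊢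
    rcases min_choice (c x) (d x) with h | h <;> rw [h] at hx' ⊢
    · exact inf_le_left.trans (hc.2 x x' hx hx')
    · exact inf_le_right.trans (hd.2 x x' hx hx')

theorem const_last : IsHeight ν δ fun _ => Fin.last n :=
  ⟨fun _ h => absurd rfl h, fun _ _ _ _ => le_rfl⟩

theorem apply_zero (hc : IsHeight ν δ c) : c 0 = Fin.last n := by
  by_contra h
  exact absurd (hc.1 0 h).1 (by omega)

theorem apply_eq_last (hc : IsHeight ν δ c) {x : ℕ} (hx : rightBound ν δ (Fin.last n) < x) :
    c x = Fin.last n := by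
  by_contra h
  have h1 := (hc.1 x h).2
  have h2 : rightBound ν δ (c x) ≤ rightBound ν δ (Fin.last n) := rightBound_mono (Fin.le_last _)
  omega

theorem le_rightBound (hc : IsHeight ν δ c) {x : ℕ} (hx : x ≤ rightBound ν δ (Fin.last n)) :
    x ≤ rightBound ν δ (c x) := by
  by_cases h : c x = Fin.last n
  · rwa [h]
  · exact (hc.1 x h).2

theorem isNode_top (hc : IsHeight ν δ c) {x : ℕ} (hx : x ≤ rightBound ν δ (Fin.last n)) :
    IsNode ν δ c (x, c x) :=
  ⟨hc.le_rightBound hx, le_rfl, hc.2 x⟩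

/-- A node left of the diagram would keep column `leftBound ν δ p.2` at height at most `p.2`. A
column of such a height lies strictly right of that bound, or the row is the last one, with bound 0.
-/
theorem leftBound_le (hδ : IsIncrementVector ν δ) (hc : IsHeight ν δ c) {p : Pt n}
    (hp : IsNode ν δ c p) : leftBound ν δ p.2 ≤ p.1 := by
  by_contra! h
  have h1 := hp.2.2 _ h (hδ.leftBound_le_rightBound _)
  by_cases h2 : c (leftBound ν δ p.2) = Fin.last n
  · rw [h2] at h1
    rw [Fin.last_le_iff.1 h1, hδ.leftBound_last] at h
    omega
  · exact (hc.1 _ h2).1.not_ge (leftBound_anti h1)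

theorem mem_treeOf (hδ : IsIncrementVector ν δ) (hc : IsHeight ν δ c) {p : Pt n} :
    p ∈ treeOf ν δ c ↔ IsNode ν δ c p := by
  classical
  rw [treeOf, Finset.mem_filter, mem_latticePoints]
  exact ⟨And.right, fun h => ⟨⟨hc.leftBound_le hδ h, h.1⟩, h⟩⟩

theorem isTree_treeOf (hδ : IsIncrementVector ν δ) (hc : IsHeight ν δ c) :
    IsTree ν δ (treeOf ν δ c) := by
  have hsw : ∀ p ∈ treeOf ν δ c, ∀ q ∈ treeOf ν δ c, ¬ SWInside ν δ p q := by
    intro p hp q hq h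
    rw [hc.mem_treeOf hδ] at hp hq
    obtain ⟨h1, h2, h3⟩ := swInside_iff.1 h
    exact ((hp.2.2 _ h1 h3).trans_lt h2).not_ge hq.2.1
  classical
  refine ⟨⟨Finset.filter_subset _ _, fun p hp q hq h => ?_⟩, ?_⟩
  · rcases h with h | h
    · exact hsw p hp q hq h
    · exact hsw q hq p hp h
  · rintro S ⟨hS1, hS2⟩ hsub p hp
    rw [hc.mem_treeOf hδ]
    have hpL := mem_latticePoints.1 (hS1 hp)
    have hlast : ∀ y, rightBound ν δ y ≤ rightBound ν δ (Fin.last n) := fun y =>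
      rightBound_mono (Fin.le_last y)
    have hnode : ∀ q, IsNode ν δ c q → q ∈ S := fun q hq => hsub ((hc.mem_treeOf hδ).2 hq)
    refine ⟨hpL.2, ?_, fun x hx hx' => ?_⟩
    · by_contra! hlt
      set y := c p.1 with hy
      have hyl : y ≠ Fin.last n := (hlt.trans_le (Fin.le_last _)).ne
      have hpy := (hc.1 p.1 hyl).2
      rw [← hy] at hpy
      -- `a` is the last column within row `y` whose top is above `y` (column 0 qualifies). Then
      -- `(a, y)` is a node, strictly southwest of `p` and incompatible with it.
      obtain ⟨a, ⟨ha1, ha2⟩, ha3⟩ : ∃ a, (a ≤ rightBound ν δ y ∧ y < c a) ∧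
          ∀ x, a < x → ¬ (x ≤ rightBound ν δ y ∧ y < c x) := by
        have h0 : 0 ≤ rightBound ν δ y ∧ y < c 0 :=
          ⟨Nat.zero_le _, by rw [hc.apply_zero]; exact Fin.lt_last_iff_ne_last.2 hyl⟩
        classical
        refine ⟨_, Nat.findGreatest_spec (P := fun a => a ≤ rightBound ν δ y ∧ y < c a)
          (Nat.zero_le (rightBound ν δ y)) h0, fun x hx hx' => ?_⟩
        exact hx.not_ge (Nat.le_findGreatest hx'.1 hx')
      have hap : a < p.1 := by
        rcases lt_trichotomy a p.1 with h | h | h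
        · exact h
        · rw [h, ← hy] at ha2
          exact absurd ha2 (lt_irrefl _)
        · exact absurd (hc.2 p.1 a h ha1) ha2.not_ge
      refine hS2 (a, y) (hnode _ ⟨ha1, ha2.le, fun x hx hx' => ?_⟩) p hp
        (Or.inl (swInside_iff.2 ⟨hap, hlt, hpy⟩))
      by_contra! hcx
      exact ha3 x hx ⟨hx', hcx⟩
    · by_contra! hlt
      exact hS2 p hp (x, c x) (hnode _ (hc.isNode_top (hx'.trans (hlast _))))
        (Or.inl (swInside_iff.2 ⟨hx, hlt, hx'⟩))

theorem le_of_treeOf (hδ : IsIncrementVector ν δ) (hd : IsHeight ν δ d)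
    (h : ∀ x ≤ rightBound ν δ (Fin.last n), ∃ y, (x, y) ∈ treeOf ν δ d ∧ c x ≤ y) : c ≤ d := by
  intro x
  rcases le_or_gt x (rightBound ν δ (Fin.last n)) with hx | hx
  · obtain ⟨y, hy, hy'⟩ := h x hx
    exact hy'.trans ((hd.mem_treeOf hδ).1 hy).2.1
  · rw [hd.apply_eq_last hx]
    exact Fin.le_last _

theorem treeOf_injective (hδ : IsIncrementVector ν δ) (hc : IsHeight ν δ c)
    (hd : IsHeight ν δ d) (h : treeOf ν δ c = treeOf ν δ d) : c = d := by
  refine le_antisymm (hd.le_of_treeOf hδ fun x hx => ?_) (hc.le_of_treeOf hδ fun x hx => ?_)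
  · exact ⟨c x, h ▸ (hc.mem_treeOf hδ).2 (hc.isNode_top hx), le_rfl⟩
  · exact ⟨d x, h ▸ (hd.mem_treeOf hδ).2 (hd.isNode_top hx), le_rfl⟩

end IsHeight

/-- Every set of pairwise compatible points is contained in the tree of a height function. -/
theorem exists_isHeight_subset_treeOf {S : Finset (Pt n)}
    (hS : S ⊆ latticePoints ν δ) (hS' : ∀ p ∈ S, ∀ q ∈ S, ¬ Incompatible ν δ p q) :
    ∃ c, IsHeight ν δ c ∧ S ⊆ treeOf ν δ c := by
  classical
  have hex : ∀ x, ∃ y, (y = Fin.last n ∨ ∃ s ∈ S, s.2 = y ∧ s.1 < x ∧ x ≤ rightBound ν δ y) ∧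
      ∀ s ∈ S, s.1 < x → x ≤ rightBound ν δ s.2 → y ≤ s.2 := by
    intro x
    -- The points of `S` that block the part of column `x` above them. The height of the column is
    -- the lowest such row, or maximal if there is none.
    set A := S.filter fun s => s.1 < x ∧ x ≤ rightBound ν δ s.2 with hA
    rcases A.eq_empty_or_nonempty with h | h
    · refine ⟨Fin.last n, Or.inl rfl, fun s hs h1 h2 => ?_⟩
      have : s ∈ A := Finset.mem_filter.2 ⟨hs, h1, h2⟩
      rw [h] at this
      exact absurd this (Finset.notMem_empty _)
    · obtain ⟨s, hs, hmin⟩ := A.exists_min_image Prod.snd h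
      obtain ⟨hs1, hs2, hs3⟩ := Finset.mem_filter.1 hs
      exact ⟨s.2, Or.inr ⟨s, hs1, rfl, hs2, hs3⟩, fun t ht h1 h2 =>
        hmin t (Finset.mem_filter.2 ⟨ht, h1, h2⟩)⟩
  choose c hc1 hc2 using hex
  refine ⟨c, ⟨fun x hx => ?_, fun x x' hx hx' => ?_⟩, fun p hp => ?_⟩
  · rcases hc1 x with h | ⟨s, hs, h1, h2, h3⟩
    · exact absurd h hx
    · refine ⟨?_, h3⟩
      have := (mem_latticePoints.1 (hS hs)).1
      rw [h1] at this
      omega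
  · rcases hc1 x with h | ⟨s, hs, h1, h2, h3⟩
    · rw [h]
      exact Fin.le_last _
    · rw [← h1]
      exact hc2 x' s hs (h2.trans hx) (by rw [h1]; exact hx')
  · refine Finset.mem_filter.2 ⟨hS hp, (mem_latticePoints.1 (hS hp)).2, ?_, fun x => hc2 x p hp⟩
    rcases hc1 p.1 with h | ⟨s, hs, h1, h2, h3⟩
    · rw [h]
      exact Fin.le_last _
    · by_contra! hlt
      refine hS' s hs p hp (Or.inl (swInside_iff.2 ⟨h2, ?_, ?_⟩))
      · rwa [h1]
      · rwa [h1]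

/-- The bijection between height functions and trees. -/
noncomputable def heightEquiv (hδ : IsIncrementVector ν δ) : HeightFn ν δ ≃ Tam ν δ :=
  Equiv.ofBijective (fun c => ⟨treeOf ν δ c.1, c.2.isTree_treeOf hδ⟩) <| by
    constructor
    · intro c d h
      exact Subtype.ext (c.2.treeOf_injective hδ d.2 (congrArg Subtype.val h))
    · rintro ⟨T, hT⟩
      obtain ⟨c, hc, hsub⟩ := exists_isHeight_subset_treeOf hT.prop.1 hT.prop.2
      exact ⟨⟨c, hc⟩, Subtype.ext (hT.eq_of_le (hc.isTree_treeOf hδ).prop hsub).symm⟩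

theorem heightEquiv_val (hδ : IsIncrementVector ν δ) (c : HeightFn ν δ) :
    (heightEquiv hδ c).1 = treeOf ν δ c.1 := rfl

/-- The node removed lies below another node of its column, so all topmost nodes survive. -/
theorem le_of_rightRotation (hδ : IsIncrementVector ν δ) {c d : HeightFn ν δ}
    (h : RightRotation (heightEquiv hδ c) (heightEquiv hδ d)) : c ≤ d := by
  obtain ⟨p, hp, q, hq, r, hr, h1, h2, h3, h4, h5, h6⟩ := h
  simp only [heightEquiv_val] at hp hq hr h6
  refine d.2.le_of_treeOf hδ fun x hx => ?_
  refine ⟨c.1 x, ?_, le_rfl⟩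
  rw [h6]
  refine Finset.mem_insert_of_mem (Finset.mem_erase.2 ⟨?_, ?_⟩)
  · rintro rfl
    have := ((c.2.mem_treeOf hδ).1 hp).2.1
    rw [h1] at this
    exact h2.not_ge this
  · exact (c.2.mem_treeOf hδ).2 (c.2.isNode_top hx)

/-! ### Rotations of height functions -/

variable (ν δ) in
/-- `x` is the first column whose topmost node has height `y`, the node of row `y` preceding it lies
in column `a`, and the next node of column `a` above row `y` has height `z`. -/
structure IsRotation (c : ℕ → Fin (n + 1)) (y : Fin (n + 1)) (a x : ℕ) (z : Fin (n + 1)) :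
    Prop where
  ne_last : y ≠ Fin.last n
  lt : a < x
  apply_eq : c x = y
  lt_apply : y < c a
  apply_lt : ∀ x', a < x' → x' < x → c x' < y
  lt_next : y < z
  isNode : IsNode ν δ c (a, z)
  not_isNode : ∀ t, y < t → t < z → ¬ IsNode ν δ c (a, t)

theorem IsHeight.exists_isRotation {c : ℕ → Fin (n + 1)} (hc : IsHeight ν δ c) {y : Fin (n + 1)}
    (hy : y ≠ Fin.last n) {x₀ : ℕ} (hx₀ : c x₀ = y) : ∃ a x z, IsRotation ν δ c y a x z := by
  classical
  have hex : ∃ x, c x = y := ⟨x₀, hx₀⟩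
  set x := Nat.find hex with hx
  have hcx : c x = y := Nat.find_spec hex
  have hmin : ∀ x' < x, c x' ≠ y := fun x' h => Nat.find_min hex h
  have hylt : y < Fin.last n := Fin.lt_last_iff_ne_last.2 hy
  have hxr : x ≤ rightBound ν δ y := by
    have := (hc.1 x (hcx ▸ hy)).2
    rwa [hcx] at this
  have h0 : y < c 0 := by rwa [hc.apply_zero]
  have hx0 : 0 < x := Nat.pos_of_ne_zero fun e => by
    rw [← hcx, e] at h0
    exact lt_irrefl _ h0
  obtain ⟨a, ha1, ha2, ha3⟩ : ∃ a, a < x ∧ y < c a ∧ ∀ x', a < x' → x' < x → c x' ≤ y := by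
    have h1 := Nat.findGreatest_spec (P := fun a => a < x ∧ y < c a) (Nat.zero_le x) ⟨hx0, h0⟩
    refine ⟨_, h1.1, h1.2, fun x' h2 h3 => ?_⟩
    by_contra! h4
    exact h2.not_ge (Nat.le_findGreatest h3.le ⟨h3, h4⟩)
  have har : a ≤ rightBound ν δ (Fin.last n) :=
    (ha1.le.trans hxr).trans (rightBound_mono (Fin.le_last _))
  set A : Finset (Fin (n + 1)) := Finset.univ.filter fun z => y < z ∧ IsNode ν δ c (a, z) with hA
  have hAne : A.Nonempty := ⟨c a, by simp [hA, ha2, hc.isNode_top har]⟩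
  have hz := A.min'_mem hAne
  obtain ⟨-, hz1, hz2⟩ := Finset.mem_filter.1 hz
  refine ⟨a, x, A.min' hAne, hy, ha1, hcx, ha2, fun x' h h' =>
    lt_of_le_of_ne (ha3 x' h h') (hmin x' h'), hz1, hz2, fun t ht ht' hn => ?_⟩
  exact ht'.not_ge (A.min'_le t (by simp [hA, ht, hn]))

namespace IsRotation

variable {c d : ℕ → Fin (n + 1)} {y z : Fin (n + 1)} {a x : ℕ}

theorem le_rightBound (h : IsRotation ν δ c y a x z) (hc : IsHeight ν δ c) :
    x ≤ rightBound ν δ y := by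
  have := (hc.1 x (h.apply_eq ▸ h.ne_last)).2
  rwa [h.apply_eq] at this

theorem apply_le (h : IsRotation ν δ c y a x z) (hc : IsHeight ν δ c) {x' : ℕ} (hx : a < x')
    (hx' : x' ≤ rightBound ν δ y) : c x' ≤ y := by
  rcases lt_trichotomy x' x with h1 | h1 | h1
  · exact (h.apply_lt x' hx h1).le
  · rw [h1, h.apply_eq]
  · have := hc.2 x x' h1 (by rwa [h.apply_eq])
    rwa [h.apply_eq] at this

theorem first_le (h : IsRotation ν δ c y a x z) (hc : IsHeight ν δ c) {x' : ℕ}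
    (hx' : c x' = y) : x ≤ x' := by
  by_contra! hlt
  rcases lt_trichotomy x' a with h1 | h1 | h1
  · have := hc.2 x' a h1 (by rw [hx']; exact h.lt.le.trans (h.le_rightBound hc))
    rw [hx'] at this
    exact h.lt_apply.not_ge this
  · have := h.lt_apply
    rw [← h1, hx'] at this
    exact lt_irrefl _ this
  · exact (h.apply_lt x' h1 hlt).ne hx'

theorem le_update (h : IsRotation ν δ c y a x z) : c ≤ Function.update c x z := by
  intro x'
  by_cases hx : x' = x
  · subst hx
    rw [Function.update_self, h.apply_eq]
    exact h.lt_next.le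
  · rw [Function.update_of_ne hx]

theorem lt_update (h : IsRotation ν δ c y a x z) : c < Function.update c x z := by
  refine lt_of_le_of_ne h.le_update fun e => ?_
  have := congrFun e x
  rw [Function.update_self, h.apply_eq] at this
  exact h.lt_next.ne this

/-- To the right of `x`, the new height is admissible because `(a, z)` is a node. To the left,
columns up to `a` whose row reaches `x` have height at least `z`, and those between `a` and `x` have
height below `y`, so their rows cannot reach `x`. -/
theorem isHeight (h : IsRotation ν δ c y a x z) (hc : IsHeight ν δ c) :
    IsHeight ν δ (Function.update c x z) := by
  have hxr := h.le_rightBound hc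
  have hx := hc.1 x (h.apply_eq ▸ h.ne_last)
  rw [h.apply_eq] at hx
  constructor
  · intro x' hx'
    by_cases e : x' = x
    · subst e
      rw [Function.update_self]
      exact ⟨(leftBound_anti h.lt_next.le).trans_lt hx.1,
        hx.2.trans (rightBound_mono h.lt_next.le)⟩
    · rw [Function.update_of_ne e] at hx' ⊢
      exact hc.1 x' hx'
  · intro x₁ x₂ h12 h2
    by_cases e1 : x₁ = x
    · subst e1
      rw [Function.update_self] at h2 ⊢
      rw [Function.update_of_ne h12.ne']
      exact h.isNode.2.2 x₂ (h.lt.trans h12) h2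
    · rw [Function.update_of_ne e1] at h2 ⊢
      by_cases e2 : x₂ = x
      · subst e2
        rw [Function.update_self]
        rcases lt_trichotomy x₁ a with h3 | h3 | h3
        · by_contra! hlt
          have := hc.2 x₁ a h3 (h.lt.le.trans h2)
          exact (hlt.trans_le (h.isNode.2.1.trans this)).false
        · rw [h3]
          exact h.isNode.2.1
        · have h4 := h.apply_lt x₁ h3 h12
          have h5 := hc.2 x₁ x₂ h12 h2
          rw [h.apply_eq] at h5
          exact absurd h4 h5.not_gt
      · rw [Function.update_of_ne e2]
        exact hc.2 x₁ x₂ h12 h2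

/-- A height function which is larger than `c` in the rotated column is larger than the
rotation of `c` there. -/
theorem le_apply (h : IsRotation ν δ c y a x z) (hc : IsHeight ν δ c) (hd : IsHeight ν δ d)
    (hcd : c ≤ d) (hx : y < d x) : z ≤ d x := by
  by_contra! hlt
  -- If `y < d x < z`, then `(a, d x)` would be a node of `c` between `(a, y)` and `(a, z)`: up to
  -- the end of row `y` the rotation bounds `c`, and beyond it `d` does.
  refine h.not_isNode _ hx hlt ⟨?_, ?_, fun x' h1 h2 => ?_⟩
  · exact h.lt.le.trans ((h.le_rightBound hc).trans (rightBound_mono hx.le))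
  · exact hlt.le.trans h.isNode.2.1
  · simp only at h1 h2 ⊢
    by_contra! h3
    have h4 : rightBound ν δ y < x' := by
      by_contra! h4
      exact ((h.apply_le hc h1 h4).trans_lt hx).not_gt h3
    have h5 := hd.2 x x' ((h.le_rightBound hc).trans_lt h4) h2
    exact (h3.trans_le (hcd x')).not_ge h5

theorem update_le (h : IsRotation ν δ c y a x z) (hc : IsHeight ν δ c) (hd : IsHeight ν δ d)
    (hcd : c ≤ d) (hx : y < d x) : Function.update c x z ≤ d := by
  intro x'
  by_cases e : x' = x
  · subst e
    rw [Function.update_self]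
    exact h.le_apply hc hd hcd hx
  · rw [Function.update_of_ne e]
    exact hcd x'

/-- A node left of `x` can be lost only if its row reaches `x` and has height in `[y, z)`. Columns
before `a` are then excluded by the node `(a, z)`, columns between `a` and `x` are too low, and
column `a` has only `(a, y)` there. -/
theorem treeOf_update (h : IsRotation ν δ c y a x z) (hδ : IsIncrementVector ν δ)
    (hc : IsHeight ν δ c) :
    treeOf ν δ (Function.update c x z) = insert (x, z) ((treeOf ν δ c).erase (a, y)) := by
  have hxr := h.le_rightBound hc
  have he := h.isHeight hc
  have hle := h.le_update
  ext ⟨x', y'⟩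
  rw [he.mem_treeOf hδ, Finset.mem_insert, Finset.mem_erase, hc.mem_treeOf hδ]
  constructor
  · rintro ⟨h1, h2, h3⟩
    simp only at h1 h2 h3
    refine or_iff_not_imp_left.2 fun hne => ⟨?_, h1, ?_, fun x₂ h4 h5 => (hle x₂).trans (h3 x₂ h4 h5)⟩
    · rintro e
      obtain ⟨rfl, rfl⟩ := Prod.mk.inj e
      have := h3 x h.lt hxr
      rw [Function.update_self] at this
      exact h.lt_next.not_ge this
    · simp only
      by_cases e : x' = x
      · subst e
        rw [Function.update_self] at h2
        rw [h.apply_eq]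
        have hyz : y' < z := lt_of_le_of_ne h2 fun e => hne (by rw [e])
        by_contra! hlt
        refine h.not_isNode y' hlt hyz ⟨h.lt.le.trans h1, hyz.le.trans h.isNode.2.1, ?_⟩
        intro x₂ h4 h5
        simp only at h4 h5 ⊢
        rcases le_or_gt x₂ x' with h6 | h6
        · exact (h.apply_le hc h4 (h6.trans hxr)).trans hlt.le
        · exact (hle x₂).trans (h3 x₂ h6 h5)
      · rwa [Function.update_of_ne e] at h2
  · rintro (e | ⟨hne, h1, h2, h3⟩)
    · obtain ⟨rfl, rfl⟩ := Prod.mk.inj e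
      refine ⟨hxr.trans (rightBound_mono h.lt_next.le), ?_, fun x₂ h4 h5 => ?_⟩
      · simp
      · simp only at h4 h5 ⊢
        rw [Function.update_of_ne h4.ne']
        exact h.isNode.2.2 x₂ (h.lt.trans h4) h5
    · simp only at h1 h2 h3
      refine ⟨h1, h2.trans (hle x'), fun x₂ h4 h5 => ?_⟩
      simp only at h4 h5 ⊢
      by_cases e : x₂ = x
      · subst e
        rw [Function.update_self]
        have hy' : y ≤ y' := h.apply_eq ▸ h3 x₂ h4 h5
        by_contra! hlt
        rcases lt_trichotomy x' a with h6 | h6 | h6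
        · have := h3 a h6 (h.lt.le.trans h5)
          exact (hlt.trans_le (h.isNode.2.1.trans this)).false
        · subst h6
          rcases hy'.lt_or_eq with h7 | h7
          · exact h.not_isNode y' h7 hlt ⟨h1, h2, h3⟩
          · exact hne (by rw [h7])
        · exact ((h.apply_lt x' h6 h4).trans_le (hy'.trans h2)).false
      · rw [Function.update_of_ne e]
        exact h3 x₂ h4 h5

theorem rightRotation (h : IsRotation ν δ c y a x z) (hδ : IsIncrementVector ν δ)
    (hc : IsHeight ν δ c) :
    RightRotation (heightEquiv hδ ⟨c, hc⟩)
      (heightEquiv hδ ⟨Function.update c x z, h.isHeight hc⟩) := by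
  have hxr := h.le_rightBound hc
  refine ⟨(a, z), (hc.mem_treeOf hδ).2 h.isNode, (a, y), (hc.mem_treeOf hδ).2 ?_, (x, y),
    (hc.mem_treeOf hδ).2 ?_, rfl, h.lt_next, rfl, h.lt, ?_, h.treeOf_update hδ hc⟩
  · exact ⟨h.lt.le.trans hxr, h.lt_apply.le, fun x' h1 h2 => h.apply_le hc h1 h2⟩
  · exact ⟨hxr, h.apply_eq.ge, fun x' h1 h2 => h.apply_le hc (h.lt.trans h1) h2⟩
  · rintro ⟨x', y'⟩ hs h1 h2 h3 h4
    rw [heightEquiv_val, hc.mem_treeOf hδ] at hs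
    simp only at h1 h2 h3 h4
    rcases h1.lt_or_eq with h5 | h5
    · rcases h2.lt_or_eq with h6 | h6
      · exact absurd ((h.apply_lt x' h5 h6).trans_le (h3.trans hs.2.1)) (lt_irrefl _)
      · subst h6
        have h7 : y' ≤ y := h.apply_eq ▸ hs.2.1
        rw [le_antisymm h7 h3]
        exact Or.inr (Or.inr rfl)
    · subst h5
      rcases h3.lt_or_eq with h6 | h6
      · rcases h4.lt_or_eq with h7 | h7
        · exact absurd hs (h.not_isNode y' h6 h7)
        · rw [h7]
          exact Or.inl rfl
      · rw [← h6]
        exact Or.inr (Or.inl rfl)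

end IsRotation

theorem finite_heightFn (hδ : IsIncrementVector ν δ) : Finite (HeightFn ν δ) :=
  Finite.of_equiv _ (heightEquiv hδ).symm

/-- Below any strictly larger height function there is a rotation. -/
theorem HeightFn.exists_isRotation_le {c d : HeightFn ν δ} (h : c < d) :
    ∃ y a x z, ∃ hr : IsRotation ν δ c.1 y a x z,
      (⟨Function.update c.1 x z, hr.isHeight c.2⟩ : HeightFn ν δ) ≤ d := by
  obtain ⟨x₀, hx₀⟩ : ∃ x₀, c.1 x₀ < d.1 x₀ := by
    by_contra! hcon
    exact h.not_ge hcon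
  have hy : c.1 x₀ ≠ Fin.last n := (hx₀.trans_le (Fin.le_last _)).ne
  obtain ⟨a, x, z, hr⟩ := c.2.exists_isRotation hy rfl
  refine ⟨_, a, x, z, hr, hr.update_le c.2 d.2 h.le ?_⟩
  have h1 : c.1 x ≤ d.1 x := h.le x
  rw [hr.apply_eq] at h1
  refine lt_of_le_of_ne h1 fun e => ?_
  -- If `d` kept height `y` in the first column `x`, its row condition would keep column `x₀` at
  -- height at most `y` too.
  rcases (hr.first_le c.2 rfl).lt_or_eq with h2 | h2
  · have h3 := d.2.2 x x₀ h2 (by rw [← e]; exact (c.2.1 x₀ hy).2)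
    rw [← e] at h3
    exact hx₀.not_ge h3
  · exact hx₀.ne (h2 ▸ e)

/-- The rotation order on trees is the pointwise order on height functions. -/
noncomputable def heightIso (hδ : IsIncrementVector ν δ) : HeightFn ν δ ≃o Tam ν δ where
  toEquiv := heightEquiv hδ
  map_rel_iff' {c d} := by
    constructor
    · intro h
      have key : ∀ T, Relation.ReflTransGen RightRotation (heightEquiv hδ c) T →
          c ≤ (heightEquiv hδ).symm T := by
        intro T hT
        induction hT with
        | refl => simp
        | tail _ hr ih =>
          refine ih.trans (le_of_rightRotation hδ ?_)
          simpa using hr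
      have := key _ h
      simpa using this
    · intro h
      have := finite_heightFn hδ
      induction c using WellFoundedGT.induction with
      | ind c ih =>
        rcases h.lt_or_eq with h | rfl
        · obtain ⟨y, a, x, z, hr, hle⟩ := HeightFn.exists_isRotation_le h
          exact Relation.ReflTransGen.head (hr.rightRotation hδ c.2)
            (ih _ hr.lt_update hle)
        · exact le_refl _

/-! ### Covers of height functions -/

/-- The rotations of `c` are its upper covers. -/
theorem HeightFn.covBy_iff {c d : HeightFn ν δ} :
    c ⋖ d ↔ ∃ y a x z, IsRotation ν δ c.1 y a x z ∧ d.1 = Function.update c.1 x z := by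
  constructor
  · intro h
    obtain ⟨y, a, x, z, hr, hle⟩ := HeightFn.exists_isRotation_le h.lt
    refine ⟨y, a, x, z, hr, ?_⟩
    rcases hle.lt_or_eq with h1 | h1
    · exact absurd h1 (h.2 hr.lt_update)
    · exact congrArg Subtype.val h1.symm
  · rintro ⟨y, a, x, z, hr, e⟩
    refine ⟨?_, fun f h1 h2 => ?_⟩
    · have := hr.lt_update
      rwa [← e] at this
    · have hfd : f.1 ≤ Function.update c.1 x z := by
        rw [← e]
        exact h2.le
      have hx : y < f.1 x := by
        have h3 : c.1 x ≤ f.1 x := h1.le x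
        rw [hr.apply_eq] at h3
        refine lt_of_le_of_ne h3 fun h4 => h1.not_ge fun x' => ?_
        by_cases e' : x' = x
        · rw [e', ← h4, hr.apply_eq]
        · have := hfd x'
          rwa [Function.update_of_ne e'] at this
      refine h2.not_ge ?_
      have := hr.update_le c.2 f.2 h1.le hx
      rw [← e] at this
      exact this

theorem HeightFn.isGLB_inf (c d : HeightFn ν δ) :
    IsGLB {c, d} (⟨c.1 ⊓ d.1, c.2.inf d.2⟩ : HeightFn ν δ) := by
  constructor
  · rintro x (rfl | rfl)
    · exact inf_le_left (a := x.1)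
    · exact inf_le_right (b := x.1)
  · intro u hu
    have h1 : u ≤ c := hu (Set.mem_insert _ _)
    have h2 : u ≤ d := hu (Set.mem_insert_of_mem _ rfl)
    exact le_inf (a := c.1) h1 h2

/-- The upper bounds of two elements include the maximal function and are closed under pointwise
minimum. -/
theorem HeightFn.isLatticeOrder [Finite (HeightFn ν δ)] :
    CanonicalJoin.IsLatticeOrder (HeightFn ν δ) := by
  refine fun c d => ⟨?_, _, HeightFn.isGLB_inf c d⟩
  refine exists_isLeast_of_directed ⟨⟨_, IsHeight.const_last⟩, fun f _ x => Fin.le_last _⟩ ?_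
  intro e he f hf
  refine ⟨⟨e.1 ⊓ f.1, e.2.inf f.2⟩, fun g hg => ?_, inf_le_left (a := e.1), inf_le_right (a := e.1)⟩
  exact le_inf (a := e.1) (he hg) (hf hg)

/-- Since `c` and `d` differ in one column `x`, being below `c` is for elements below `d` the single
inequality `e x ≤ y`. Heights form a chain, so its failure is preserved by minima. -/
theorem HeightFn.exists_isLeast [Finite (HeightFn ν δ)] {c d : HeightFn ν δ} (h : c ⋖ d) :
    ∃ j, IsLeast {e | e ≤ d ∧ ¬ e ≤ c} j := by
  obtain ⟨y, a, x, z, hr, he⟩ := HeightFn.covBy_iff.1 h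
  have key : ∀ e : HeightFn ν δ, e ≤ d → (e ≤ c ↔ e.1 x ≤ y) := by
    intro e hed
    refine ⟨fun h => hr.apply_eq ▸ h x, fun h x' => ?_⟩
    by_cases e' : x' = x
    · rw [e', hr.apply_eq]
      exact h
    · have : e.1 x' ≤ d.1 x' := hed x'
      rwa [he, Function.update_of_ne e'] at this
  refine exists_isLeast_of_directed ⟨d, le_rfl, h.lt.not_ge⟩ ?_
  rintro e ⟨he1, he2⟩ f ⟨hf1, hf2⟩
  rw [key e he1] at he2
  rw [key f hf1] at hf2
  have hle : (⟨e.1 ⊓ f.1, e.2.inf f.2⟩ : HeightFn ν δ) ≤ d :=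
    (inf_le_left (a := e.1) (b := f.1)).trans he1
  refine ⟨_, ⟨hle, ?_⟩, inf_le_left (a := e.1), inf_le_right (a := e.1)⟩
  rw [key _ hle]
  simp only [Pi.inf_apply, not_le] at he2 hf2 ⊢
  exact lt_inf_iff.2 ⟨he2, hf2⟩

theorem HeightFn.exists_isGreatest {c d : HeightFn ν δ} (h : c ⋖ d) :
    ∃ m, IsGreatest {e | c ≤ e ∧ ¬ d ≤ e} m := by
  obtain ⟨y, a, x, z, hr, he⟩ := HeightFn.covBy_iff.1 h
  have hx := c.2.1 x (hr.apply_eq ▸ hr.ne_last)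
  rw [hr.apply_eq] at hx
  -- An element above `c` but not above `d` has height exactly `y` in column `x`, hence at most `y`
  -- from `x` to the end of row `y`. The largest such function is maximal elsewhere.
  set m : ℕ → Fin (n + 1) := fun x' =>
    if x ≤ x' ∧ x' ≤ rightBound ν δ y then y else Fin.last n with hm
  have hm1 : ∀ x', x ≤ x' → x' ≤ rightBound ν δ y → m x' = y := fun x' h1 h2 => if_pos ⟨h1, h2⟩
  have hm2 : ∀ x', (m x' = y ∧ x ≤ x' ∧ x' ≤ rightBound ν δ y) ∨ m x' = Fin.last n := by
    intro x'
    by_cases h : x ≤ x' ∧ x' ≤ rightBound ν δ y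
    · exact Or.inl ⟨if_pos h, h⟩
    · exact Or.inr (if_neg h)
  have hle : ∀ e : HeightFn ν δ, e.1 x ≤ y → ∀ x', x ≤ x' → x' ≤ rightBound ν δ y → c ≤ e →
      e.1 x' ≤ y := by
    intro e h1 x' h2 h3 h4
    have h5 : e.1 x = y := le_antisymm h1 (hr.apply_eq ▸ h4 x)
    rcases h2.lt_or_eq with h2 | h2
    · have := e.2.2 x x' h2 (by rwa [h5])
      rwa [h5] at this
    · rw [← h2, h5]
  have hmH : IsHeight ν δ m := by
    constructor
    · intro x' hx'
      rcases hm2 x' with ⟨h1, h2, h3⟩ | h1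
      · rw [h1]
        exact ⟨hx.1.trans_le h2, h3⟩
      · exact absurd h1 hx'
    · intro x₁ x₂ h1 h2
      rcases hm2 x₁ with ⟨h3, h4, h5⟩ | h3
      · rw [h3] at h2 ⊢
        rw [hm1 x₂ (h4.trans h1.le) h2]
      · rw [h3]
        exact Fin.le_last _
  have hmle : ∀ e : HeightFn ν δ, c ≤ e → e.1 x ≤ y → e.1 ≤ m := by
    intro e h1 h2 x'
    rcases hm2 x' with ⟨h3, h4, h5⟩ | h3
    · rw [h3]
      exact hle e h2 x' h4 h5 h1
    · rw [h3]
      exact Fin.le_last _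
  refine ⟨⟨m, hmH⟩, ⟨hmle c le_rfl hr.apply_eq.le, fun hdm => ?_⟩, ?_⟩
  · have h1 : d.1 x ≤ m x := hdm x
    rw [hm1 x le_rfl hx.2, he, Function.update_self] at h1
    exact hr.lt_next.not_ge h1
  · rintro e ⟨h1, h2⟩
    refine hmle e h1 ?_
    by_contra! h3
    refine h2 ?_
    have := hr.update_le c.2 e.2 h1 h3
    rw [← he] at this
    exact this

/-- The upper covers of `c` correspond to the non-maximal heights that `c` takes. -/
theorem HeightFn.card_upperCovers [Finite (HeightFn ν δ)] (c : HeightFn ν δ) :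
    {d | c ⋖ d}.ncard = {i : Fin n | ∃ x, c.1 x = i.castSucc}.ncard := by
  have hch : ∀ i : Fin n, (∃ x, c.1 x = i.castSucc) →
      ∃ a x z, IsRotation ν δ c.1 i.castSucc a x z := by
    rintro i ⟨x, hx⟩
    exact c.2.exists_isRotation (Fin.castSucc_ne_last i) hx
  choose a x z hr using hch
  symm
  refine Set.ncard_congr (fun i hi => ⟨Function.update c.1 (x i hi) (z i hi),
    (hr i hi).isHeight c.2⟩) ?_ ?_ ?_
  · exact fun i hi => HeightFn.covBy_iff.2 ⟨_, _, _, _, hr i hi, rfl⟩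
  · intro i j hi hj h
    have h1 := congrArg Subtype.val h
    simp only at h1
    have h2 := congrFun h1 (x i hi)
    rw [Function.update_self] at h2
    by_cases hx : x i hi = x j hj
    · have h3 := (hr i hi).apply_eq
      rw [hx, (hr j hj).apply_eq] at h3
      exact (Fin.castSucc_injective _ h3).symm
    · rw [Function.update_of_ne hx, (hr i hi).apply_eq] at h2
      exact absurd h2 (hr i hi).lt_next.ne'
  · intro d hd
    obtain ⟨y, a', x', z', hr', he⟩ := HeightFn.covBy_iff.1 hd
    obtain ⟨i, rfl⟩ := Fin.exists_castSucc_eq.2 hr'.ne_last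
    have hi : ∃ x, c.1 x = i.castSucc := ⟨x', hr'.apply_eq⟩
    have h1 := hr i hi
    refine ⟨i, hi, Subtype.ext ?_⟩
    simp only [he]
    have hxx : x i hi = x' := le_antisymm (h1.first_le c.2 hr'.apply_eq)
      (hr'.first_le c.2 h1.apply_eq)
    have hle := h1.update_le c.2 d.2 hd.le (by
      rw [he, hxx, Function.update_self]
      exact hr'.lt_next)
    have hle' := hr'.update_le c.2 (h1.isHeight c.2) h1.le_update (by
      rw [← hxx, Function.update_self]
      exact h1.lt_next)
    rw [he] at hle
    exact le_antisymm hle hle'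

end AltTamari

/-! ### Height functions and `ν`-paths -/

namespace AltTamari

variable {n : ℕ} {ν : NEPath n} {δ : Fin n → ℕ}

variable (ν) in
/-- The path whose number of east steps at height `y` is the number of columns, other than the
first one, to which `c` assigns the height `y`. -/
def pathOf (c : ℕ → Fin (n + 1)) : NEPath n := fun y =>
  ((Finset.Icc 1 (∑ i, ν i)).filter fun x => c x = y).card

theorem sum_pathOf (c : ℕ → Fin (n + 1)) (Y : Finset (Fin (n + 1))) :
    ∑ y ∈ Y, pathOf ν c y = ((Finset.Icc 1 (∑ i, ν i)).filter fun x => c x ∈ Y).card := by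
  rw [Finset.card_eq_sum_card_fiberwise (f := c) (t := Y)
    (s := (Finset.Icc 1 (∑ i, ν i)).filter fun x => c x ∈ Y)
    (fun x hx => (Finset.mem_filter.1 (Finset.mem_coe.1 hx)).2)]
  refine Finset.sum_congr rfl fun y hy => ?_
  rw [pathOf, Finset.filter_filter]
  congr 1
  ext x
  simp only [Finset.mem_filter, and_congr_right_iff]
  exact fun _ => ⟨fun h => ⟨h ▸ hy, h⟩, And.right⟩

theorem sum_univ_pathOf (c : ℕ → Fin (n + 1)) : ∑ y, pathOf ν c y = ∑ y, ν y := by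
  rw [sum_pathOf]
  simp

namespace IsHeight

variable {c d : ℕ → Fin (n + 1)}

theorem mem_Icc (hδ : IsIncrementVector ν δ) (hc : IsHeight ν δ c) {x : ℕ}
    (hx : c x ≠ Fin.last n) : x ∈ Finset.Icc 1 (∑ i, ν i) := by
  have h1 := hc.1 x hx
  have h2 : rightBound ν δ (c x) ≤ rightBound ν δ (Fin.last n) := rightBound_mono (Fin.le_last _)
  rw [hδ.rightBound_last] at h2
  rw [Finset.mem_Icc]
  omega

/-- For `y` below the last row, columns of height at most `y` lie in row `y` and are not its first
point, so there are at most `ν.reach y` of them. -/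
theorem isNuPath_pathOf (hδ : IsIncrementVector ν δ) (hc : IsHeight ν δ c) :
    IsNuPath ν (pathOf ν c) := by
  refine ⟨sum_univ_pathOf c, fun y => ?_⟩
  by_cases hy : y = Fin.last n
  · subst hy
    have : Finset.Iic (Fin.last n) = Finset.univ := by
      ext i
      simp [Fin.le_last]
    rw [NEPath.reach, NEPath.reach, this, sum_univ_pathOf]
  · have h1 : ν.reach y = (Finset.Ioc (leftBound ν δ y) (rightBound ν δ y)).card := by
      rw [Nat.card_Ioc, hδ.rightBound_eq]
      omega
    rw [NEPath.reach, sum_pathOf, h1]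
    refine Finset.card_le_card fun x hx => ?_
    have hxy : c x ≤ y := Finset.mem_Iic.1 (Finset.mem_filter.1 hx).2
    have hx' := hc.1 x (hxy.trans_lt (Fin.lt_last_iff_ne_last.2 hy)).ne
    rw [Finset.mem_Ioc]
    exact ⟨(leftBound_anti hxy).trans_lt hx'.1, hx'.2.trans (rightBound_mono hxy)⟩

theorem valleys_pathOf (hδ : IsIncrementVector ν δ) (hc : IsHeight ν δ c) :
    (pathOf ν c).valleys = {i : Fin n | ∃ x, c x = i.castSucc}.ncard := by
  rw [NEPath.valleys, ← Set.ncard_coe_finset]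
  congr 1
  ext i
  simp only [Finset.coe_filter, Finset.mem_univ, true_and, pathOf, Finset.card_pos,
    Set.mem_ofPred_eq]
  constructor
  · rintro ⟨x, hx⟩
    exact ⟨x, (Finset.mem_filter.1 hx).2⟩
  · rintro ⟨x, hx⟩
    exact ⟨x, Finset.mem_filter.2 ⟨hc.mem_Icc hδ (hx ▸ Fin.castSucc_ne_last i), hx⟩⟩

/-- Once the columns of smaller heights are known, those of height `y` are the last ones still free
in row `y`, so their number determines them. -/
theorem pathOf_injective (hδ : IsIncrementVector ν δ) (hc : IsHeight ν δ c)
    (hd : IsHeight ν δ d) (h : pathOf ν c = pathOf ν d) : c = d := by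
  have step : ∀ {c d : ℕ → Fin (n + 1)} (_ : IsHeight ν δ c) (_ : IsHeight ν δ d)
      (y : Fin (n + 1)), y ≠ Fin.last n → (∀ y' < y, ∀ x, c x = y' ↔ d x = y') →
      ∀ x x', c x = y → d x ≠ y → d x' = y → c x' ≠ y → ¬ x < x' := by
    intro c d hc hd y hy ih x x' h1 h2 h3 h4 hlt
    have h5 := hc.2 x x' hlt (by rw [h1, ← h3]; exact (hd.1 x' (h3 ▸ hy)).2)
    rw [h1] at h5
    have h6 := lt_of_le_of_ne h5 h4
    have h7 := (ih _ h6 x').1 rfl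
    rw [h3] at h7
    exact h6.ne' h7
  have key : ∀ y : Fin (n + 1), y ≠ Fin.last n → ∀ x, c x = y ↔ d x = y := by
    intro y
    induction y using WellFoundedLT.induction with
    | ind y ih =>
      intro hy
      have ih' : ∀ y' < y, ∀ x, c x = y' ↔ d x = y' := fun y' h' =>
        ih y' h' (h'.trans_le (Fin.le_last _)).ne
      have hcard : ((Finset.Icc 1 (∑ i, ν i)).filter fun x => c x = y).card =
          ((Finset.Icc 1 (∑ i, ν i)).filter fun x => d x = y).card := congrFun h y
      have heq : ((Finset.Icc 1 (∑ i, ν i)).filter fun x => c x = y) =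
          ((Finset.Icc 1 (∑ i, ν i)).filter fun x => d x = y) := by
        by_contra hne
        have h1 : ¬ ((Finset.Icc 1 (∑ i, ν i)).filter fun x => c x = y) ⊆
            ((Finset.Icc 1 (∑ i, ν i)).filter fun x => d x = y) := fun hs =>
          hne (Finset.eq_of_subset_of_card_le hs hcard.ge)
        have h2 : ¬ ((Finset.Icc 1 (∑ i, ν i)).filter fun x => d x = y) ⊆
            ((Finset.Icc 1 (∑ i, ν i)).filter fun x => c x = y) := fun hs =>
          hne (Finset.eq_of_subset_of_card_le hs hcard.le).symm
        obtain ⟨x, hx, hx'⟩ := Finset.not_subset.1 h1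
        obtain ⟨w, hw, hw'⟩ := Finset.not_subset.1 h2
        simp only [Finset.mem_filter, not_and] at hx hx' hw hw'
        have h3 := step hc hd y hy ih' x w hx.2 (hx' hx.1) hw.2 (hw' hw.1)
        have h4 := step hd hc y hy (fun y' h' x => (ih' y' h' x).symm) w x hw.2 (hw' hw.1) hx.2
          (hx' hx.1)
        have : x = w := by omega
        subst this
        exact hx' hx.1 hw.2
      intro x
      have hx := Finset.ext_iff.1 heq x
      simp only [Finset.mem_filter] at hx
      exact ⟨fun h1 => (hx.1 ⟨hc.mem_Icc hδ (h1 ▸ hy), h1⟩).2,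
        fun h1 => (hx.2 ⟨hd.mem_Icc hδ (h1 ▸ hy), h1⟩).2⟩
  funext x
  by_cases hx : c x = Fin.last n
  · by_contra hne
    exact hne ((key (d x) (fun e => hne (hx.trans e.symm)) x).2 rfl)
  · exact ((key (c x) hx x).1 rfl).symm

end IsHeight

/-- A finite set of naturals has final segments of all possible cardinalities. -/
theorem exists_final_segment (k : ℕ) (A : Finset ℕ) (hk : k ≤ A.card) :
    ∃ S ⊆ A, S.card = k ∧ ∀ a ∈ S, ∀ b ∈ A, a < b → b ∈ S := by
  induction k generalizing A with
  | zero => exact ⟨∅, Finset.empty_subset _, rfl, by simp⟩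
  | succ k ih =>
    have hne : A.Nonempty := Finset.card_pos.1 (by omega)
    obtain ⟨S, hS, hcard, hup⟩ := ih (A.erase (A.max' hne)) (by
      rw [Finset.card_erase_of_mem (A.max'_mem hne)]
      omega)
    have hmS : A.max' hne ∉ S := fun h => Finset.notMem_erase _ _ (hS h)
    refine ⟨insert (A.max' hne) S, ?_, ?_, ?_⟩
    · exact Finset.insert_subset (A.max'_mem hne) (hS.trans (Finset.erase_subset _ _))
    · rw [Finset.card_insert_of_notMem hmS, hcard]
    · intro a ha b hb hab
      rcases Finset.mem_insert.1 ha with rfl | ha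
      · exact absurd (A.le_max' b hb) hab.not_ge
      · by_cases hbm : b = A.max' hne
        · exact Finset.mem_insert.2 (Or.inl hbm)
        · exact Finset.mem_insert_of_mem (hup a ha b (Finset.mem_erase.2 ⟨hbm, hb⟩) hab)

/-- Rows are filled from the bottom, each taking the last `μ y` free columns. The path condition
says that enough are free; taking a final segment gives the row condition of `IsHeight`. -/
theorem exists_isHeight_pathOf_eq (hδ : IsIncrementVector ν δ) {μ : NEPath n}
    (hμ : IsNuPath ν μ) : ∃ c, IsHeight ν δ c ∧ pathOf ν c = μ := by
  have key : ∀ k ≤ n, ∃ c, IsHeight ν δ c ∧ (∀ x, c x = Fin.last n ∨ (c x).val < k) ∧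
      ∀ y : Fin (n + 1), y.val < k → pathOf ν c y = μ y := by
    intro k
    induction k with
    | zero => exact fun _ => ⟨_, IsHeight.const_last, fun _ => Or.inl rfl, fun _ h => by omega⟩
    | succ k ih =>
      intro hk
      obtain ⟨c, hc, hck, hcμ⟩ := ih (by omega)
      set y : Fin (n + 1) := ⟨k, by omega⟩ with hy
      have hyl : y ≠ Fin.last n := fun e => by
        have := congrArg Fin.val e
        simp [hy] at this
        omega
      set I := Finset.Ioc (leftBound ν δ y) (rightBound ν δ y) with hI
      set A := I.filter fun x => c x = Fin.last n with hA
      have hAcard : μ y ≤ A.card := by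
        have h1 : I.card = ν.reach y := by
          rw [hI, Nat.card_Ioc, hδ.rightBound_eq]
          omega
        have h2 : (I.filter fun x => ¬ c x = Fin.last n).card ≤ ∑ i ∈ Finset.Iio y, μ i := by
          rw [← Finset.sum_congr rfl fun i hi => hcμ i (Fin.lt_def.1 (Finset.mem_Iio.1 hi)), sum_pathOf]
          refine Finset.card_le_card fun x hx => ?_
          have hx' := (Finset.mem_filter.1 hx).2
          refine Finset.mem_filter.2 ⟨hc.mem_Icc hδ hx', Finset.mem_Iio.2 ?_⟩
          exact (hck x).resolve_left hx'
        have h3 := Finset.card_filter_add_card_filter_not (s := I) fun x => c x = Fin.last n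
        rw [← hA] at h3
        have h4 := hμ.2 y
        have h5 : μ.reach y = μ y + ∑ i ∈ Finset.Iio y, μ i := by
          rw [NEPath.reach, ← Finset.Iio_insert, Finset.sum_insert (by simp)]
        omega
      obtain ⟨S, hSA, hScard, hSup⟩ := exists_final_segment _ A hAcard
      have hS : ∀ x ∈ S, leftBound ν δ y < x ∧ x ≤ rightBound ν δ y ∧ c x = Fin.last n := by
        intro x hx
        have h1 := Finset.mem_filter.1 (hSA hx)
        have h2 := Finset.mem_Ioc.1 h1.1
        exact ⟨h2.1, h2.2, h1.2⟩
      set d : ℕ → Fin (n + 1) := fun x => if x ∈ S then y else c x with hd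
      have hd1 : ∀ x ∈ S, d x = y := fun x hx => if_pos hx
      have hd2 : ∀ x, x ∉ S → d x = c x := fun x hx => if_neg hx
      have hdH : IsHeight ν δ d := by
        constructor
        · intro x hx
          by_cases hxS : x ∈ S
          · rw [hd1 x hxS]
            exact ⟨(hS x hxS).1, (hS x hxS).2.1⟩
          · rw [hd2 x hxS] at hx ⊢
            exact hc.1 x hx
        · intro x x' hxx hx'
          by_cases hxS : x ∈ S
          · rw [hd1 x hxS] at hx' ⊢
            by_cases hx'S : x' ∈ S
            · rw [hd1 x' hx'S]
            · rw [hd2 x' hx'S]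
              rcases hck x' with h1 | h1
              · exact absurd (hSup x hxS x' (Finset.mem_filter.2 ⟨Finset.mem_Ioc.2
                  ⟨(hS x hxS).1.trans hxx, hx'⟩, h1⟩) hxx) hx'S
              · exact Fin.le_def.2 h1.le
          · rw [hd2 x hxS] at hx' ⊢
            have h1 := hc.2 x x' hxx hx'
            by_cases hx'S : x' ∈ S
            · rw [(hS x' hx'S).2.2, Fin.last_le_iff] at h1
              rw [h1]
              exact Fin.le_last _
            · rwa [hd2 x' hx'S]
      refine ⟨d, hdH, fun x => ?_, fun y' hy' => ?_⟩
      · by_cases hxS : x ∈ S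
        · rw [hd1 x hxS]
          exact Or.inr (Nat.lt_succ_self k)
        · rw [hd2 x hxS]
          exact (hck x).imp_right fun h => by omega
      · rcases (Nat.lt_succ_iff.1 hy').lt_or_eq with h1 | h1
        · rw [← hcμ y' h1, pathOf, pathOf]
          congr 1
          refine Finset.filter_congr fun x _ => ?_
          by_cases hxS : x ∈ S
          · rw [hd1 x hxS, (hS x hxS).2.2]
            refine iff_of_false (fun e => ?_) (fun e => ?_)
            · rw [← e] at h1
              exact lt_irrefl _ h1
            · rw [← e, Fin.val_last] at h1
              omega
          · rw [hd2 x hxS]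
        · have hyy : y' = y := Fin.ext h1
          rw [hyy, ← hScard, pathOf]
          congr 1
          ext x
          rw [Finset.mem_filter]
          constructor
          · rintro ⟨-, h2⟩
            by_contra hxS
            rw [hd2 x hxS] at h2
            rcases hck x with h3 | h3
            · exact hyl (h2.symm.trans h3)
            · rw [h2] at h3
              exact lt_irrefl _ h3
          · intro hxS
            exact ⟨hdH.mem_Icc hδ (hd1 x hxS ▸ hyl), hd1 x hxS⟩
  obtain ⟨c, hc, -, hcμ⟩ := key n le_rfl
  refine ⟨c, hc, funext fun y => ?_⟩
  have h1 : ∀ i : Fin n, pathOf ν c i.castSucc = μ i.castSucc := fun i => hcμ _ i.isLt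
  -- The last row is settled by the total number of east steps.
  have h2 : ∑ y, pathOf ν c y = ∑ y, μ y := by rw [sum_univ_pathOf, hμ.1]
  rw [Fin.sum_univ_castSucc, Fin.sum_univ_castSucc, Finset.sum_congr rfl fun i _ => h1 i] at h2
  induction y using Fin.lastCases with
  | last => omega
  | cast i => exact h1 i

/-! ### Narayana polynomial and Euler characteristic -/

theorem narayana_eq (hδ : IsIncrementVector ν δ) (i : ℕ) :
    narayana ν i = {c : HeightFn ν δ | {d | c ⋖ d}.ncard = i}.ncard := by
  have := finite_heightFn hδ
  have e : {μ : NEPath n | IsNuPath ν μ ∧ μ.valleys = i} =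
      (fun c : HeightFn ν δ => pathOf ν c.1) '' {c | {d | c ⋖ d}.ncard = i} := by
    ext μ
    constructor
    · rintro ⟨h1, h2⟩
      obtain ⟨c, hc, rfl⟩ := exists_isHeight_pathOf_eq hδ h1
      refine ⟨⟨c, hc⟩, ?_, rfl⟩
      rw [Set.mem_ofPred_eq, HeightFn.card_upperCovers, ← hc.valleys_pathOf hδ, h2]
    · rintro ⟨c, hc, rfl⟩
      refine ⟨c.2.isNuPath_pathOf hδ, ?_⟩
      rw [c.2.valleys_pathOf hδ, ← HeightFn.card_upperCovers]
      exact hc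
  rw [narayana, e, Set.ncard_image_of_injective]
  exact fun c d h => Subtype.ext (c.2.pathOf_injective hδ d.2 h)

theorem eval_narayanaPoly (hδ : IsIncrementVector ν δ) [Fintype (HeightFn ν δ)] (t : ℤ) :
    (narayanaPoly ν).eval t = ∑ c : HeightFn ν δ, t ^ {d | c ⋖ d}.ncard := by
  classical
  have hle : ∀ c : HeightFn ν δ, {d | c ⋖ d}.ncard ∈ Finset.range (n + 1) := by
    intro c
    rw [HeightFn.card_upperCovers, Finset.mem_range, Nat.lt_succ_iff]
    refine (Set.ncard_le_card _).trans ?_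
    simp
  rw [narayanaPoly, Polynomial.eval_finsetSum,
    ← Finset.sum_fiberwise_of_maps_to (fun c _ => hle c)]
  refine Finset.sum_congr rfl fun i _ => ?_
  rw [Finset.sum_congr rfl fun c hc => by rw [(Finset.mem_filter.1 hc).2], Finset.sum_const,
    narayana_eq hδ, nsmul_eq_mul, ← Set.ncard_coe_finset]
  simp

/-- The Euler characteristic of the canonical join complex of the rotation lattice. -/
theorem eulerChar_tam (hδ : IsIncrementVector ν δ) :
    ∃ h : CanonicalJoin.IsLatticeOrder (Tam ν δ),
      (∀ T : Tam ν δ, ∃ A, CanonicalJoin.IsCanonicalJoinRep A T) ∧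
      eulerChar (CanonicalJoin.canonicalJoinComplex h) = 1 - (narayanaPoly ν).eval (-1) := by
  classical
  have := finite_heightFn hδ
  have := Fintype.ofFinite (HeightFn ν δ)
  have := Fintype.ofFinite (Tam ν δ)
  set e := heightIso hδ
  have hL : CanonicalJoin.IsLatticeOrder (Tam ν δ) := by
    intro T T'
    obtain ⟨⟨s, hs⟩, i, hi⟩ := HeightFn.isLatticeOrder (e.symm T) (e.symm T')
    refine ⟨⟨e s, ?_⟩, e i, ?_⟩
    · have := e.isLUB_image'.2 hs
      simpa [Set.image_pair] using this
    · have := e.isGLB_image'.2 hi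
      simpa [Set.image_pair] using this
  have hcov : ∀ {T T' : Tam ν δ}, T ⋖ T' → e.symm T ⋖ e.symm T' := fun h =>
    (apply_covBy_apply_iff e.symm).2 h
  choose sup hsup using fun a b => (hL a b).1
  choose inf hinf using fun a b => (hL a b).2
  let inst : Lattice (Tam ν δ) :=
    { (inferInstance : PartialOrder (Tam ν δ)) with
      sup := sup
      inf := inf
      le_sup_left := fun a b => (hsup a b).1 (by simp)
      le_sup_right := fun a b => (hsup a b).1 (by simp)
      sup_le := fun a b c h1 h2 => (hsup a b).2 (by rintro x (rfl | rfl) <;> assumption)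
      inf_le_left := fun a b => (hinf a b).1 (by simp)
      inf_le_right := fun a b => (hinf a b).1 (by simp)
      le_inf := fun a b c h1 h2 => (hinf b c).2 (by rintro x (rfl | rfl) <;> assumption) }
  obtain ⟨J, hJ⟩ := CanonicalJoin.exists_isJoinLabelling (P := Tam ν δ) fun T T' h => by
    obtain ⟨j, hj⟩ := HeightFn.exists_isLeast (hcov h)
    refine ⟨e j, ⟨?_, ?_⟩, fun x hx => ?_⟩
    · exact e.le_symm_apply.1 hj.1.1
    · exact fun h' => hj.1.2 (e.le_symm_apply.2 h')
    · refine e.le_symm_apply.1 (hj.2 ⟨e.symm.monotone hx.1, fun h' => hx.2 ?_⟩)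
      exact e.symm.le_iff_le.1 h'
  obtain ⟨M, hM⟩ := CanonicalJoin.exists_isMeetLabelling (P := Tam ν δ) fun T T' h => by
    obtain ⟨m, hm⟩ := HeightFn.exists_isGreatest (hcov h)
    refine ⟨e m, ⟨?_, ?_⟩, fun x hx => ?_⟩
    · exact e.symm_apply_le.1 hm.1.1
    · exact fun h' => hm.1.2 (e.symm_apply_le.2 h')
    · refine e.symm_apply_le.1 (hm.2 ⟨e.symm.monotone hx.1, fun h' => hx.2 ?_⟩)
      exact e.symm.le_iff_le.1 h'
  have hne : Nonempty (Tam ν δ) := ⟨e ⟨_, IsHeight.const_last⟩⟩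
  refine ⟨hL, fun T => ⟨_, hJ.isCanonicalJoinRep T⟩, ?_⟩
  refine (hJ.eulerChar_eq_sum_lowerCovers hL).trans ?_
  rw [CanonicalJoin.sum_lowerCovers_eq_sum_upperCovers hJ hM, eval_narayanaPoly hδ]
  congr 1
  refine (Fintype.sum_equiv e.toEquiv _ _ fun c => ?_).symm
  congr 1
  rw [← Set.ncard_coe_finset, ← Set.ncard_image_of_injective _ e.injective]
  congr 1
  ext T
  simp only [Set.mem_image, Set.mem_ofPred_eq, Finset.coe_filter, Finset.mem_univ, true_and]
  constructor
  · rintro ⟨d, hd, rfl⟩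
    exact (apply_covBy_apply_iff e).2 hd
  · intro hT
    refine ⟨e.symm T, ?_, e.apply_symm_apply T⟩
    have := hcov hT
    simpa using this

end AltTamari

theorem proposition1p4 (n : ℕ) (ν : AltTamari.NEPath n) :
    (∀ δ : Fin n → ℕ, AltTamari.IsIncrementVector ν δ →
      ∃ h : CanonicalJoin.IsLatticeOrder (AltTamari.Tam ν δ),
        (∀ T : AltTamari.Tam ν δ, ∃ A, CanonicalJoin.IsCanonicalJoinRep A T) ∧
        eulerChar (CanonicalJoin.canonicalJoinComplex h) =
          1 - (AltTamari.narayanaPoly ν).eval (-1)) ∧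
    (∀ δ δ' : Fin n → ℕ, AltTamari.IsIncrementVector ν δ → AltTamari.IsIncrementVector ν δ' →
      ∀ (h : CanonicalJoin.IsLatticeOrder (AltTamari.Tam ν δ))
        (h' : CanonicalJoin.IsLatticeOrder (AltTamari.Tam ν δ')),
        eulerChar (CanonicalJoin.canonicalJoinComplex h) =
          eulerChar (CanonicalJoin.canonicalJoinComplex h')) := by
  refine ⟨fun δ hδ => AltTamari.eulerChar_tam hδ, fun δ δ' hδ hδ' h h' => ?_⟩
  -- Proof irrelevance identifies the lattice proof obtained here with `h`.
  obtain ⟨_, -, h1⟩ := AltTamari.eulerChar_tam hδ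
  obtain ⟨_, -, h2⟩ := AltTamari.eulerChar_tam hδ'
  exact h1.trans h2.symm
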